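/- Consider a two-armed stochastic bandit with Bernoulli arms of means $0<\mu_2<\mu_1<1$. At each time $t\ge 1$ a policy chooses, possibly at random, an arm $A_t\in\{1,2\}$ on the basis of the past observations $(A_1,R_1,\dots,A_{t-1},R_{t-1})$, and then receives a reward $R_t$ which, given these observations and $A_t$, has the Bernoulli law $\mathrm{B}(\mu_{A_t})$. Let $N_a(t)$ be the number of times $i<t$ with $A_i=a$, and let $\hat\mu_a(t)$ be the average of the rewards received from arm $a$ at these times. UCB is a policy that at every time $t$ pulls an arm $a$ maximizing the index $$\hat\mu_a(t)+\sqrt{\frac{2\log t}{N_a(t)}},$$ which is $+\infty$ if $N_a(t)=0$; ties are broken arbitrarily. The exploration episodes are $$\tau_1:=\inf\{t\ge 1: A_t=2\},\qquad \tau_{k+1}:=\inf\{t>\tau_k: A_t=2 \text{ and } A_{t-1}=1\}.$$ For $T\ge 1$ let $\mathrm{Reg}(s;s+T):=T\mu_1-\sum_{i=0}^{T-1}\mu_{A_{s+i}}$ be the pseudo-regret over the $T$ rounds $s,\dots,s+T-1$, and let the regret of exploration be $$\mathrm{RegExp}(T):=\limsup_{k\to\infty}\mathbb{E}\big[\mathrm{Reg}(\tau_k;\tau_k+T)\big].$$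 Let $(X_i)_{i\ge 1}$ be i.i.d. random variables with law $\mathrm{B}(\mu_2)$, and set $$\sigma_T:=T\wedge\inf\Big\{t\ge 1:\ -\frac{\mu_1-\mu_2}{2}+\frac1t\sum_{i=1}^t (X_i-\mu_2)\le 0\Big\}.$$ **Theorem.** When UCB is run, all exploration episodes $\tau_k$ are almost surely finite, and for every integer $T\ge 1$, $$\mathrm{RegExp}(T)\ \ge\ (\mu_1-\mu_2)\,\mathbb{E}[\sigma_T].$$ -/

import Mathlib

open MeasureTheory ProbabilityTheory Filter

noncomputable section

namespace TwoArmBandit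

/-- Arms are the elements of `Fin 2`: `0` stands for arm 1 and `1` for arm 2. Rewards are Boolean
(`true` is the reward one, `false` the reward zero). `History n` is the type of the observations
`(A_1, R_1, …, A_n, R_n)`; the entry with index `i : Fin n` is `(A_{i+1}, R_{i+1})`. -/
abbrev History (n : ℕ) : Type := Fin n → Fin 2 × Bool

/-- A (possibly randomized) policy: given the observations of the first `n` rounds, `π n h` is the
law of the arm pulled in round `n + 1`. -/
abbrev Policy : Type := (n : ℕ) → History n → PMF (Fin 2)

/-- The observations of the rounds `1, …, n`. -/
def history {Ω : Type*} (A : ℕ → Ω → Fin 2) (R : ℕ → Ω → Bool) (n : ℕ) (ω : Ω) : History n :=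
  fun i => (A ((i : ℕ) + 1) ω, R ((i : ℕ) + 1) ω)

/-- `(A_t, R_t)`, `t ≥ 1`, is a run of the policy `π` on the two-armed bandit with Bernoulli arms of
means `μ`: given the past observations the arm is drawn from `π`, and then the reward is drawn from
the Bernoulli law of that arm, independently of everything else. The values at `t = 0` play no
role. -/
structure IsRun {Ω : Type*} [MeasurableSpace Ω] (P : Measure Ω) (μ : Fin 2 → unitInterval)
    (π : Policy) (A : ℕ → Ω → Fin 2) (R : ℕ → Ω → Bool) : Prop where
  measurable_arm : ∀ t, Measurable (A t)
  measurable_reward : ∀ t, Measurable (R t)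
  law : ∀ (n : ℕ) (h : History n) (a : Fin 2) (r : Bool),
    P {ω | history A R n ω = h ∧ A (n + 1) ω = a ∧ R (n + 1) ω = r} =
      P {ω | history A R n ω = h} * π n h a * bernoulliMeasure true false (μ a) {r}

/-- `N_a(n + 1)`: the number of pulls of arm `a` in the rounds `1, …, n`. -/
def numVisits {n : ℕ} (h : History n) (a : Fin 2) : ℕ :=
  (Finset.univ.filter fun i => (h i).1 = a).card

/-- `S_a(n + 1)`: the number of rewards one received from arm `a` in the rounds `1, …, n`. -/
def numSuccesses {n : ℕ} (h : History n) (a : Fin 2) : ℕ :=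
  (Finset.univ.filter fun i => h i = (a, true)).card

/-- The UCB index of arm `a` at time `t = n + 1`, namely
`S_a(t) / N_a(t) + √(2 log t / N_a(t))`, and `+∞` if the arm has not been pulled yet. -/
def ucbIndex {n : ℕ} (h : History n) (a : Fin 2) : EReal :=
  if numVisits h a = 0 then ⊤
  else (((numSuccesses h a : ℝ) / numVisits h a
    + √(2 * Real.log ((n : ℝ) + 1) / numVisits h a) : ℝ) : EReal)

/-- `π` is a UCB policy: it only pulls arms of maximal UCB index. Ties are broken arbitrarily,
possibly at random and depending on the history. -/
def IsUCB (π : Policy) : Prop :=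
  ∀ (n : ℕ) (h : History n) (a : Fin 2), π n h a ≠ 0 → ∀ b : Fin 2, ucbIndex h b ≤ ucbIndex h a

/-- `inf {t : p t}`, equal to `∞` if there is no such `t`. -/
def firstTime (p : ℕ → Prop) : ℕ∞ := ⨅ (t : ℕ) (_ : p t), (t : ℕ∞)

/-- The exploration episodes of a sequence of arms `a 1, a 2, …`. They are numbered from `0`:
`explorationEpisode a k` is `τ_{k+1}`. -/
def explorationEpisode (a : ℕ → Fin 2) : ℕ → ℕ∞
  | 0 => firstTime fun t => 1 ≤ t ∧ a t = 1
  | k + 1 => firstTime fun t => explorationEpisode a k < (t : ℕ∞) ∧ a t = 1 ∧ a (t - 1) = 0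

/-- The pseudo-regret `Reg(s; s + T)` over the `T` rounds `s, …, s + T - 1`, arm 1 being optimal. -/
def pseudoRegret (μ : Fin 2 → unitInterval) (a : ℕ → Fin 2) (s T : ℕ) : ℝ :=
  (T : ℝ) * (μ 0 : ℝ) - ∑ i ∈ Finset.range T, (μ (a (s + i)) : ℝ)

/-- The pseudo-regret over the `T` rounds that start with the exploration episode of index `k`; by
convention zero if that episode never happens. -/
def explorationRegret (μ : Fin 2 → unitInterval) (a : ℕ → Fin 2) (k T : ℕ) : ℝ :=
  if explorationEpisode a k = ⊤ then 0 else pseudoRegret μ a (explorationEpisode a k).toNat T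

/-- The regret of exploration: the limsup over `k` of the expected pseudo-regret over the `T` rounds
that start with the exploration episode of index `k`. -/
def regExp {Ω : Type*} [MeasurableSpace Ω] (P : Measure Ω) (μ : Fin 2 → unitInterval)
    (A : ℕ → Ω → Fin 2) (T : ℕ) : ℝ :=
  limsup (fun k => ∫ ω, explorationRegret μ (fun t => A t ω) k T ∂P) atTop

/-- `T ∧ inf {t ≥ 1 : -(m₁ - m₂)/2 + (1/t) ∑_{i=1}^t (x_i - m₂) ≤ 0}`. -/
def walkTime (m₁ m₂ : ℝ) (T : ℕ) (x : ℕ → ℝ) : ℕ :=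
  (min (T : ℕ∞) (firstTime fun t =>
    1 ≤ t ∧ -(m₁ - m₂) / 2 + 1 / (t : ℝ) * ∑ i ∈ Finset.Icc 1 t, (x i - m₂) ≤ 0)).toNat

end TwoArmBandit

end

/-! The regret of an episode is the gap `Δ = μ 0 - μ 1` times the number of pulls of arm two in its
window. Its expectation is therefore `Δ` times a sum over `s < T` of the probabilities that arm two
is pulled `s` rounds after the start. These are bounded below by counting only initial streaks of
arm two.

Let `N` be the number of pulls of arm two when a late episode starts. Arm one was chosen one round
earlier, which forces the bonus of arm two to be at most `Δ + o(1)`; the start itself puts the index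
of arm two at least level with that of arm one. After `s` consecutive pulls with total reward `j`,
the empirical mean of arm two has moved by about `(j - s * μ 1) / N`, its bonus has lost at most
about `Δ * s / (2 * N)`, and the index of arm one has grown by only `o(1 / N)`. So the streak
continues once `j - s * μ 1 - s * Δ / 2 > 0` (`IsGreedy.streak_continues`). This is exactly the
condition that the walk defining `σ_T` has not stopped at time `s`.

The threshold for "late" depends on the trajectory, but almost sure validity for all large `k` makes
the probability of an early stop vanish (`IsRun.tendsto_real_streak_stops`). By the strong Markov
property, the rewards of a streak have, in the limit, the product Bernoulli law on optimistic words
(`IsRun.tendsto_real_streakEvent`). Summing over words gives `P(σ_T > s)`, and summing over `s < T`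
gives the expectation of `σ_T`.

The empirical means converge because each arm is pulled infinitely often and its successive rewards
are pairwise independent and identically distributed. -/

noncomputable section

namespace TwoArmBandit

/-! ### Deterministic analysis of UCB trajectories -/

/-- The number of pulls of arm `b` in the rounds `1, …, n` of a sequence of arms. -/
abbrev visits (a : ℕ → Fin 2) (b : Fin 2) (n : ℕ) : ℕ := Nat.count (fun t => a (t + 1) = b) n

/-- The number of rewards one received from arm `b` in the rounds `1, …, n`. -/
abbrev successes (a : ℕ → Fin 2) (r : ℕ → Bool) (b : Fin 2) (n : ℕ) : ℕ :=
  Nat.count (fun t => (a (t + 1), r (t + 1)) = (b, true)) n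

lemma numVisits_history {Ω : Type*} (A : ℕ → Ω → Fin 2) (R : ℕ → Ω → Bool) (n : ℕ) (ω : Ω)
    (b : Fin 2) : numVisits (history A R n ω) b = visits (fun t => A t ω) b n := by
  rw [numVisits, Finset.card_filter, visits, Nat.count_eq_card_filter_range, Finset.card_filter]
  exact Fin.sum_univ_eq_sum_range (fun i => if A (i + 1) ω = b then 1 else 0) n

lemma numSuccesses_history {Ω : Type*} (A : ℕ → Ω → Fin 2) (R : ℕ → Ω → Bool) (n : ℕ) (ω : Ω)
    (b : Fin 2) : numSuccesses (history A R n ω) b =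
      successes (fun t => A t ω) (fun t => R t ω) b n := by
  rw [numSuccesses, Finset.card_filter, successes, Nat.count_eq_card_filter_range,
    Finset.card_filter]
  exact Fin.sum_univ_eq_sum_range
    (fun i => if (A (i + 1) ω, R (i + 1) ω) = (b, true) then 1 else 0) n

/-- The real-valued UCB index, meaningful when the arm has been pulled. -/
def realIndex (a : ℕ → Fin 2) (r : ℕ → Bool) (b : Fin 2) (n : ℕ) : ℝ :=
  (successes a r b n : ℝ) / visits a b n + √(2 * Real.log ((n : ℝ) + 1) / visits a b n)

/-- A trajectory that always pulls an arm of maximal UCB index. -/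
def IsGreedy (a : ℕ → Fin 2) (r : ℕ → Bool) : Prop :=
  ∀ n b, 0 < visits a (a (n + 1)) n →
    0 < visits a b n ∧ realIndex a r b n ≤ realIndex a r (a (n + 1)) n

lemma isGreedy_of_ucbIndex_le {Ω : Type*} (A : ℕ → Ω → Fin 2) (R : ℕ → Ω → Bool) (ω : Ω)
    (h : ∀ n b, ucbIndex (history A R n ω) b ≤ ucbIndex (history A R n ω) (A (n + 1) ω)) :
    IsGreedy (fun t => A t ω) (fun t => R t ω) := by
  intro n b hpos
  have h' := h n b
  simp only [ucbIndex, numVisits_history, numSuccesses_history] at h'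
  rw [if_neg hpos.ne'] at h'
  split_ifs at h' with h0
  · exact absurd (top_le_iff.1 h') (EReal.coe_ne_top _)
  · exact ⟨Nat.pos_of_ne_zero h0, EReal.coe_le_coe_iff.1 h'⟩

lemma visits_add_visits (a : ℕ → Fin 2) {b c : Fin 2} (hbc : b ≠ c) (n : ℕ) :
    visits a b n + visits a c n = n := by
  induction n with
  | zero => simp
  | succ n ih =>
    have : a (n + 1) = b ∧ ¬ a (n + 1) = c ∨ ¬ a (n + 1) = b ∧ a (n + 1) = c := by omega
    simp only [visits, Nat.count_succ] at ih ⊢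
    rcases this with ⟨h1, h2⟩ | ⟨h1, h2⟩
    · rw [if_pos h1, if_neg h2]; omega
    · rw [if_neg h1, if_pos h2]; omega

lemma successes_le_visits (a : ℕ → Fin 2) (r : ℕ → Bool) (b : Fin 2) (n : ℕ) :
    successes a r b n ≤ visits a b n :=
  Nat.count_mono_left fun _ _ h => (Prod.ext_iff.1 h).1

lemma successes_div_visits_le_one (a : ℕ → Fin 2) (r : ℕ → Bool) (b : Fin 2) (n : ℕ) :
    (successes a r b n : ℝ) / visits a b n ≤ 1 :=
  div_le_one_of_le₀ (by exact_mod_cast successes_le_visits a r b n) (by positivity)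

lemma log_nat_add_one_nonneg (n : ℕ) : 0 ≤ Real.log ((n : ℝ) + 1) :=
  Real.log_nonneg (by linarith [(Nat.cast_nonneg n : (0 : ℝ) ≤ n)])

lemma tendsto_log_nat_add_one : Tendsto (fun n : ℕ => Real.log ((n : ℝ) + 1)) atTop atTop :=
  Real.tendsto_log_atTop.comp
    (tendsto_atTop_add_const_right _ _ tendsto_natCast_atTop_atTop)

/-- Along a UCB trajectory each arm is pulled infinitely often. -/
lemma IsGreedy.tendsto_visits {a : ℕ → Fin 2} {r : ℕ → Bool} (h : IsGreedy a r) (b : Fin 2) :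
    Tendsto (visits a b) atTop atTop := by
  obtain ⟨c, hbc⟩ : ∃ c : Fin 2, b ≠ c := ⟨b + 1, by fin_cases b <;> simp⟩
  have hother : ∀ n, a (n + 1) ≠ b → a (n + 1) = c := fun n hn => by omega
  by_contra hnot
  rcases tendsto_atTop_of_monotone (Nat.count_monotone fun t => a (t + 1) = b) with ht | ⟨m, hm⟩
  · exact hnot ht
  rw [nhds_discrete, tendsto_pure] at hm
  obtain ⟨n₀, hn₀⟩ := eventually_atTop.1 hm
  have hc : ∀ n ≥ n₀, a (n + 1) = c := by
    intro n hn
    refine hother n fun hb => ?_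
    have h1 := hn₀ n hn
    have h2 := hn₀ (n + 1) (by omega)
    rw [Nat.count_succ, if_pos hb] at h2
    omega
  have hvc : ∀ n ≥ n₀, visits a c n = n - m := fun n hn => by
    have := visits_add_visits a hbc n
    have := hn₀ n hn
    simp only [visits] at *
    omega
  have key : ∀ n ≥ n₀, m < n → 0 < m ∧ realIndex a r b n ≤ realIndex a r c n := by
    intro n hn hmn
    have := h n b (by rw [hc n hn, hvc n hn]; omega)
    rw [hc n hn] at this
    exact ⟨by simpa only [visits, hn₀ n hn] using this.1, this.2⟩
  have hm0 : 0 < m := (key (max n₀ (m + 1)) (by omega) (by omega)).1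
  -- The bound `log > 2 * m` makes the bonus `B` of arm `b` exceed 2. The bound `n ≥ 5 * m` gives
  -- the other arm at least `4 * m` pulls, hence a bonus of at most `B / 2`. With an empirical mean
  -- of at most 1, optimality of `c` would give `B ≤ 1 + B / 2`.
  obtain ⟨n, hlog, hn⟩ := ((tendsto_log_nat_add_one.eventually
    (eventually_gt_atTop (2 * (m : ℝ)))).and (eventually_ge_atTop (max n₀ (5 * m)))).exists
  have hle := (key n (by omega) (by omega)).2
  have hmR : (0 : ℝ) < m := by exact_mod_cast hm0
  have hV : (4 * m : ℝ) ≤ visits a c n := by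
    rw [hvc n (by omega)]
    exact_mod_cast (by omega : 4 * m ≤ n - m)
  have hb : √(2 * Real.log ((n : ℝ) + 1) / m) ≤ realIndex a r b n := by
    rw [realIndex, visits, hn₀ n (by omega)]
    have : (0 : ℝ) ≤ (successes a r b n : ℝ) / m := by positivity
    linarith
  have hlogn := log_nat_add_one_nonneg n
  have hcb : √(2 * Real.log ((n : ℝ) + 1) / visits a c n) ≤
      √(2 * Real.log ((n : ℝ) + 1) / m) / 2 := by
    refine Real.sqrt_le_iff.2 ⟨by positivity, ?_⟩
    rw [div_pow, Real.sq_sqrt (by positivity), div_div]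
    exact div_le_div_of_nonneg_left (by positivity) (by positivity) (by linarith)
  have h1 := successes_div_visits_le_one a r c n
  have h2 : (2 : ℝ) < √(2 * Real.log ((n : ℝ) + 1) / m) := by
    refine Real.lt_sqrt_of_sq_lt ?_
    rw [lt_div_iff₀ hmR]
    linarith
  rw [realIndex] at hle hb
  rw [realIndex] at hle
  linarith

/-- The empirical means of the arms converge to `m`. -/
def MeansConverge (a : ℕ → Fin 2) (r : ℕ → Bool) (m : Fin 2 → ℝ) : Prop :=
  ∀ b, Tendsto (fun n => (successes a r b n : ℝ) / visits a b n) atTop (nhds (m b))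

/-- Once the empirical means differ by at least half the gap `δ`, arm two can only be pulled while
its bonus is at least `δ`, that is, while its count is at most `2 * log / δ ^ 2`. The constant `C`
absorbs the rounds before that and the last pull. -/
lemma IsGreedy.exists_visits_one_le {a : ℕ → Fin 2} {r : ℕ → Bool} (h : IsGreedy a r)
    {m : Fin 2 → ℝ} (hm : MeansConverge a r m) (hgap : m 1 < m 0) :
    ∃ C D : ℝ, ∀ᶠ n in atTop, (visits a 1 n : ℝ) ≤ C + D * Real.log ((n : ℝ) + 1) := by
  set δ := (m 0 - m 1) / 2 with hδ
  have hδ0 : 0 < δ := by linarith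
  have hev : ∀ᶠ n in atTop, 0 < visits a 1 n ∧
      δ ≤ (successes a r 0 n : ℝ) / visits a 0 n - (successes a r 1 n : ℝ) / visits a 1 n := by
    refine ((h.tendsto_visits 1).eventually_gt_atTop 0).and ?_
    exact ((hm 0).sub (hm 1)).eventually (eventually_ge_nhds (by linarith))
  obtain ⟨n₀, hn₀⟩ := eventually_atTop.1 hev
  have hstep : ∀ n ≥ n₀, a (n + 1) = 1 →
      (visits a 1 n : ℝ) ≤ 2 / δ ^ 2 * Real.log ((n : ℝ) + 1) := by
    intro n hn ha
    obtain ⟨hpos, hd⟩ := hn₀ n hn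
    have hle := (h n 0 (by rw [ha]; exact hpos)).2
    rw [ha, realIndex, realIndex] at hle
    have hs : δ ≤ √(2 * Real.log ((n : ℝ) + 1) / visits a 1 n) := by
      linarith [Real.sqrt_nonneg (2 * Real.log ((n : ℝ) + 1) / visits a 0 n)]
    have hV : (0 : ℝ) < visits a 1 n := by exact_mod_cast hpos
    have h2 := (Real.le_sqrt' hδ0).1 hs
    rw [le_div_iff₀ hV] at h2
    rw [div_mul_eq_mul_div, le_div_iff₀ (by positivity)]
    linarith
  refine ⟨visits a 1 n₀ + 1, 2 / δ ^ 2, eventually_atTop.2 ⟨n₀, fun n hn => ?_⟩⟩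
  induction n, hn using Nat.le_induction with
  | base =>
    have := log_nat_add_one_nonneg n₀
    have : 0 ≤ 2 / δ ^ 2 * Real.log ((n₀ : ℝ) + 1) := by positivity
    linarith
  | succ n hn ih =>
    have hlog : 2 / δ ^ 2 * Real.log ((n : ℝ) + 1) ≤
        2 / δ ^ 2 * Real.log (((n + 1 : ℕ) : ℝ) + 1) := by
      gcongr
      omega
    by_cases ha : a (n + 1) = 1
    · have h1 := hstep n hn ha
      have h2 : visits a 1 (n + 1) = visits a 1 n + 1 := by simp [visits, Nat.count_succ, ha]
      rw [h2, Nat.cast_add, Nat.cast_one]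
      linarith [(Nat.cast_nonneg (visits a 1 n₀) : (0 : ℝ) ≤ _)]
    · have h2 : visits a 1 (n + 1) = visits a 1 n := by simp [visits, Nat.count_succ, ha]
      rw [h2]
      linarith

lemma tendsto_log_nat_add_one_div : Tendsto (fun n : ℕ => Real.log ((n : ℝ) + 1) / n) atTop
    (nhds 0) := by
  have h1 : Tendsto (fun x : ℝ => Real.log x / x) atTop (nhds 0) := by
    simpa using Real.isLittleO_log_id_atTop.tendsto_div_nhds_zero
  have h2 := h1.comp (tendsto_atTop_add_const_right _ (1 : ℝ)
    (tendsto_natCast_atTop_atTop (R := ℝ)))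
  have h3 : Tendsto (fun n : ℕ => ((n : ℝ) + 1) / n) atTop (nhds 1) := by
    have := (tendsto_const_nhds (x := (1 : ℝ))).add tendsto_one_div_atTop_nhds_zero_nat
    rw [add_zero] at this
    refine this.congr' ?_
    filter_upwards [eventually_gt_atTop 0] with n hn
    have : (0 : ℝ) < n := by exact_mod_cast hn
    field_simp
  have := h2.mul h3
  rw [zero_mul] at this
  refine this.congr fun n => ?_
  have : (n : ℝ) + 1 ≠ 0 := by positivity
  simp only [Function.comp]
  field_simp

/-- As arm two takes only logarithmically many rounds, arm one has at least `n / 2` pulls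
eventually, so its bonus vanishes. -/
lemma IsGreedy.tendsto_log_div_visits_zero {a : ℕ → Fin 2} {r : ℕ → Bool} (h : IsGreedy a r)
    {m : Fin 2 → ℝ} (hm : MeansConverge a r m) (hgap : m 1 < m 0) :
    Tendsto (fun n : ℕ => 2 * Real.log ((n : ℝ) + 1) / visits a 0 n) atTop (nhds 0) := by
  obtain ⟨C, D, hCD⟩ := h.exists_visits_one_le hm hgap
  have hsmall : Tendsto (fun n : ℕ => C / n + D * (Real.log ((n : ℝ) + 1) / n)) atTop
      (nhds 0) := by
    simpa using (tendsto_const_nhds.div_atTop tendsto_natCast_atTop_atTop).add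
      (tendsto_log_nat_add_one_div.const_mul D)
  have hbig : Tendsto (fun n : ℕ => 4 * (Real.log ((n : ℝ) + 1) / n)) atTop (nhds 0) := by
    simpa using tendsto_log_nat_add_one_div.const_mul 4
  refine squeeze_zero' ?_ ?_ hbig
  · exact Eventually.of_forall fun n => by have := log_nat_add_one_nonneg n; positivity
  · filter_upwards [hCD, hsmall.eventually (eventually_le_nhds (by norm_num : (0 : ℝ) < 1 / 2)),
      eventually_gt_atTop 0] with n h1 h2 hn
    have hn' : (0 : ℝ) < n := by exact_mod_cast hn
    have hsum : (visits a 0 n : ℝ) + visits a 1 n = n := by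
      exact_mod_cast visits_add_visits a (by decide) n
    have h3 : C + D * Real.log ((n : ℝ) + 1) ≤ n / 2 := by
      have : (C / n + D * (Real.log ((n : ℝ) + 1) / n)) * n ≤ 1 / 2 * n := by gcongr
      have e : (C / n + D * (Real.log ((n : ℝ) + 1) / n)) * n =
        C + D * Real.log ((n : ℝ) + 1) := by field_simp
      linarith
    have h4 : (n : ℝ) / 2 ≤ visits a 0 n := by linarith
    have h5 := log_nat_add_one_nonneg n
    calc 2 * Real.log ((n : ℝ) + 1) / visits a 0 n ≤ 2 * Real.log ((n : ℝ) + 1) / (n / 2) :=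
          div_le_div_of_nonneg_left (by positivity) (by positivity) h4
      _ = 4 * (Real.log ((n : ℝ) + 1) / n) := by field_simp; ring

lemma visits_succ_of_eq {a : ℕ → Fin 2} {b : Fin 2} {n : ℕ} (h : a (n + 1) = b) :
    visits a b (n + 1) = visits a b n + 1 := by
  rw [visits, Nat.count_succ, if_pos h]

lemma visits_succ_of_ne {a : ℕ → Fin 2} {b : Fin 2} {n : ℕ} (h : a (n + 1) ≠ b) :
    visits a b (n + 1) = visits a b n := by
  rw [visits, Nat.count_succ, if_neg h]
  rfl

lemma successes_succ_of_ne {a : ℕ → Fin 2} {r : ℕ → Bool} {b : Fin 2} {n : ℕ}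
    (h : a (n + 1) ≠ b) : successes a r b (n + 1) = successes a r b n := by
  rw [successes, Nat.count_succ, if_neg (fun h' => h (Prod.ext_iff.1 h').1)]
  rfl

lemma successes_succ_of_eq {a : ℕ → Fin 2} {r : ℕ → Bool} {b : Fin 2} {n : ℕ}
    (h : a (n + 1) = b) :
    successes a r b (n + 1) = successes a r b n + if r (n + 1) = true then 1 else 0 := by
  rw [successes, Nat.count_succ]
  by_cases hr : r (n + 1) = true
  · rw [if_pos (by rw [h, hr]), if_pos hr]
  · rw [if_neg (fun h' => hr (Prod.ext_iff.1 h').2), if_neg hr]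

lemma sqrt_add_le_sqrt_add_sqrt {x y : ℝ} (hx : 0 ≤ x) (hy : 0 ≤ y) : √(x + y) ≤ √x + √y :=
  Real.sqrt_le_iff.2 ⟨by positivity, by
    nlinarith [Real.sq_sqrt hx, Real.sq_sqrt hy, Real.sqrt_nonneg x, Real.sqrt_nonneg y,
      mul_nonneg (Real.sqrt_nonneg x) (Real.sqrt_nonneg y)]⟩

/-- When the exploration of arm two starts after the round `n` played arm one, the exploration
bonus of arm two is asymptotically at most the gap. -/
lemma IsGreedy.exists_bonus_le {a : ℕ → Fin 2} {r : ℕ → Bool} (h : IsGreedy a r)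
    {m : Fin 2 → ℝ} (hm : MeansConverge a r m) (hgap : m 1 < m 0) :
    ∃ g : ℕ → ℝ, Tendsto g atTop (nhds (m 0 - m 1)) ∧ ∀ᶠ n : ℕ in atTop, a n = 0 →
      √(2 * Real.log ((n : ℝ) + 1) / visits a 1 n) ≤ g n := by
  let f : ℕ → ℝ := fun n => (successes a r 0 n : ℝ) / visits a 0 n
    - (successes a r 1 n : ℝ) / visits a 1 n
    + √(2 * Real.log ((n : ℝ) + 1) / visits a 0 n)
  have hf : Tendsto f atTop (nhds (m 0 - m 1)) := by
    have := (h.tendsto_log_div_visits_zero hm hgap).sqrt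
    rw [Real.sqrt_zero] at this
    have h' := ((hm 0).sub (hm 1)).add this
    rwa [add_zero] at h'
  have hz : Tendsto (fun n => √(2 / (visits a 1 n : ℝ))) atTop (nhds 0) := by
    have := (tendsto_const_nhds (x := (2 : ℝ))).div_atTop
      (tendsto_natCast_atTop_atTop.comp (h.tendsto_visits 1))
    simpa using this.sqrt
  -- The choice of arm one in round `n` compares indices after `n - 1` observations, whence `f (n -
  -- 1)`. The second term pays for the one-step growth of the logarithm, which is at most 1; the
  -- count of arm two does not change in that round.
  refine ⟨fun n => f (n - 1) + √(2 / (visits a 1 n : ℝ)), ?_, ?_⟩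
  · simpa using (hf.comp (tendsto_sub_atTop_nat 1)).add hz
  · have hpos : ∀ᶠ n in atTop, 0 < visits a 0 (n - 1) :=
      ((h.tendsto_visits 0).comp (tendsto_sub_atTop_nat 1)).eventually_gt_atTop 0
    filter_upwards [hpos, eventually_gt_atTop 1] with n hn h1 ha
    obtain ⟨l, rfl⟩ : ∃ l, n = l + 1 := ⟨n - 1, by omega⟩
    rw [Nat.add_sub_cancel] at hn ⊢
    have hle := (h l 1 (by rw [ha]; exact hn)).2
    rw [ha, realIndex, realIndex] at hle
    have hne : a (l + 1) ≠ 1 := by rw [ha]; decide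
    rw [visits_succ_of_ne hne]
    have hl : (0 : ℝ) < l := by exact_mod_cast (by omega : 0 < l)
    have hlog : Real.log (((l + 1 : ℕ) : ℝ) + 1) ≤ Real.log ((l : ℝ) + 1) + 1 := by
      have he : Real.log (((l : ℝ) + 1) * Real.exp 1) = Real.log ((l : ℝ) + 1) + 1 := by
        rw [Real.log_mul (by positivity) (Real.exp_pos _).ne', Real.log_exp]
      rw [← he]
      refine Real.log_le_log (by positivity) ?_
      push_cast
      nlinarith [Real.add_one_le_exp (1 : ℝ)]
    have hsq : √(2 * Real.log (((l + 1 : ℕ) : ℝ) + 1) / visits a 1 l) ≤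
        √(2 * Real.log ((l : ℝ) + 1) / visits a 1 l) + √(2 / (visits a 1 l : ℝ)) := by
      refine (Real.sqrt_le_sqrt ?_).trans (sqrt_add_le_sqrt_add_sqrt ?_ ?_)
      · rw [← add_div]
        gcongr
        linarith
      · have := log_nat_add_one_nonneg l
        positivity
      · positivity
    simp only [f]
    linarith

/-- Tangent line of the convex function `u ↦ (1 + u)^(-1/2)` at 0, with `u = s / N`. For `s < 2 * N`
it is squared and becomes `(1 - x) ^ 2 * (1 + 2 * x) ≤ 1` with `x = s / (2 * N)`; otherwise the left
side is nonpositive. -/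
lemma sqrt_div_add_ge {L N s : ℝ} (hL : 0 ≤ L) (hN : 0 < N) (hs : 0 ≤ s) :
    √(L / N) - √(L / N) * s / (2 * N) ≤ √(L / (N + s)) := by
  rcases le_or_gt (2 * N) s with hsN | hsN
  · refine le_trans ?_ (Real.sqrt_nonneg _)
    have : 1 ≤ s / (2 * N) := by rwa [le_div_iff₀ (by positivity), one_mul]
    have h2 := mul_le_mul_of_nonneg_left this (Real.sqrt_nonneg (L / N))
    rw [mul_div_assoc]
    linarith
  · refine Real.le_sqrt_of_sq_le ?_
    have e : (√(L / N) - √(L / N) * s / (2 * N)) ^ 2 = L / N * (1 - s / (2 * N)) ^ 2 := by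
      rw [← Real.sq_sqrt (div_nonneg hL hN.le), Real.sqrt_sq (Real.sqrt_nonneg _)]
      ring
    rw [e, le_div_iff₀ (by positivity)]
    have e2 : L / N * (1 - s / (2 * N)) ^ 2 * (N + s) =
        L * ((1 - s / (2 * N)) ^ 2 * (1 + s / N)) := by
      field_simp
    rw [e2]
    refine mul_le_of_le_one_right hL ?_
    obtain ⟨x, rfl⟩ : ∃ x, s = 2 * N * x := ⟨s / (2 * N), by field_simp⟩
    have e3 : 2 * N * x / (2 * N) = x := by field_simp
    have e4 : 2 * N * x / N = 2 * x := by field_simp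
    rw [e3, e4]
    have hx0 : 0 ≤ x := by
      by_contra hx
      have : 2 * N * x < 0 := mul_neg_of_pos_of_neg (by positivity) (by linarith)
      linarith
    have hx1 : x ≤ 1 := by
      by_contra hx
      nlinarith
    nlinarith [mul_nonneg hx0 hx0, mul_nonneg (mul_nonneg hx0 hx0) (sub_nonneg.2 hx1)]

/-- Evolution of the counts of arm two during a streak of pulls of that arm. -/
lemma streak_counts {a : ℕ → Fin 2} {r : ℕ → Bool} {n s : ℕ}
    (h : ∀ i < s, a (n + 1 + i) = 1) :
    visits a 1 (n + s) = visits a 1 n + s ∧ visits a 0 (n + s) = visits a 0 n ∧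
      successes a r 0 (n + s) = successes a r 0 n ∧
      successes a r 1 (n + s) = successes a r 1 n + Nat.count (fun i => r (n + 1 + i) = true) s := by
  induction s with
  | zero => simp
  | succ s ih =>
    obtain ⟨h1, h2, h3, h4⟩ := ih fun i hi => h i (by omega)
    have hs : a (n + s + 1) = 1 := by
      have := h s (by omega)
      rwa [show n + 1 + s = n + s + 1 by omega] at this
    have hs0 : a (n + s + 1) ≠ 0 := by rw [hs]; decide
    rw [← add_assoc, visits_succ_of_eq hs, visits_succ_of_ne hs0, successes_succ_of_ne hs0,
      successes_succ_of_eq hs, h1, h2, h3, h4, Nat.count_succ,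
      show n + 1 + s = n + s + 1 by omega]
    refine ⟨by omega, rfl, rfl, by omega⟩

/-- If arm two has been pulled `s` times in a row since the start `n + 1` of an exploration episode,
with rewards that exceed the mean by more than half the gap on average, then UCB pulls it again,
provided the episode starts late enough. -/
lemma IsGreedy.streak_continues {a : ℕ → Fin 2} {r : ℕ → Bool} (h : IsGreedy a r)
    {m : Fin 2 → ℝ} (hm : MeansConverge a r m) (hgap : m 1 < m 0) (s j : ℕ)
    (hj : 0 < (j : ℝ) - s * m 1 - s * (m 0 - m 1) / 2) :
    ∀ᶠ n : ℕ in atTop, a n = 0 → a (n + 1) = 1 → (∀ i < s, a (n + 1 + i) = 1) →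
      Nat.count (fun i => r (n + 1 + i) = true) s = j → a (n + 1 + s) = 1 := by
  obtain ⟨g, hg, hbonus⟩ := h.exists_bonus_le hm hgap
  have hN1 : Tendsto (fun n => (visits a 1 n : ℝ)) atTop atTop :=
    tendsto_natCast_atTop_atTop.comp (h.tendsto_visits 1)
  have hN0 : Tendsto (fun n => (visits a 0 n : ℝ)) atTop atTop :=
    tendsto_natCast_atTop_atTop.comp (h.tendsto_visits 0)
  have hratio : Tendsto (fun n => (visits a 1 n : ℝ) / (visits a 1 n + s)) atTop (nhds 1) := by
    have h1 := (tendsto_const_nhds (x := (1 : ℝ))).sub ((tendsto_const_nhds (x := (s : ℝ))).div_atTop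
      (tendsto_atTop_add_const_right _ (s : ℝ) hN1))
    rw [sub_zero] at h1
    refine h1.congr' ?_
    filter_upwards [hN1.eventually_gt_atTop 0] with n hn
    have : (visits a 1 n : ℝ) + s ≠ 0 := by positivity
    field_simp
    ring
  -- Lower bound for the lead of arm two after the streak, multiplied by its count at the start. The
  -- terms are the change of its mean, the loss of its bonus and the growth of the bonus of arm one.
  -- The limit is the quantity in `hj`.
  have hdrift : Tendsto (fun n => (visits a 1 n : ℝ) / (visits a 1 n + s) *
      (j - s * ((successes a r 1 n : ℝ) / visits a 1 n)) - g n * s / 2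
      - 2 * s / √(visits a 0 n)) atTop (nhds (1 * (j - s * m 1) - (m 0 - m 1) * s / 2 - 0)) :=
    ((hratio.mul (tendsto_const_nhds.sub ((hm 1).const_mul _))).sub
      ((hg.mul_const _).div_const _)).sub
      (tendsto_const_nhds.div_atTop (Real.tendsto_sqrt_atTop.comp hN0))
  have hpos := hdrift.eventually (eventually_gt_nhds (show (0 : ℝ) < _ by linarith))
  filter_upwards [hpos, hbonus, hN1.eventually_gt_atTop 0, hN0.eventually_gt_atTop 0,
    eventually_gt_atTop 0] with n hd hb h1 h0 hn ha0 ha1 hstreak hcount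
  by_contra hne
  have hne' : a (n + s + 1) = 0 := by
    rw [show n + s + 1 = n + 1 + s by omega]
    omega
  obtain ⟨e1, e2, e3, e4⟩ := streak_counts (r := r) hstreak
  rw [hcount] at e4
  -- If the streak stops, arm one leads after `n + s` rounds, while arm two leads after `n`.
  -- Combining the two inequalities leaves only increments, and these contradict the positive drift.
  have hlate := (h (n + s) 1 (by rw [hne', e2]; exact_mod_cast h0)).2
  have hstart := (h n 0 (by rw [ha1]; exact_mod_cast h1)).2
  rw [hne'] at hlate
  rw [ha1] at hstart
  rw [realIndex, realIndex, e1, e2, e3, e4] at hlate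
  rw [realIndex, realIndex] at hstart
  have hb := hb ha0
  have hN1n : (visits a 1 n : ℝ) ≤ n := by
    have := visits_add_visits a (show (1 : Fin 2) ≠ 0 by decide) n
    exact_mod_cast (by omega : visits a 1 n ≤ n)
  push_cast at hlate
  generalize (visits a 1 n : ℝ) = N at *
  generalize (visits a 0 n : ℝ) = M at *
  generalize (successes a r 1 n : ℝ) = S at *
  generalize (successes a r 0 n : ℝ) / M = q at *
  have hs0 : (0 : ℝ) ≤ s := Nat.cast_nonneg s
  have hnR : (1 : ℝ) ≤ n := by exact_mod_cast hn
  have hL0 := log_nat_add_one_nonneg n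
  have hLmono : Real.log ((n : ℝ) + 1) ≤ Real.log ((n : ℝ) + s + 1) :=
    Real.log_le_log (by linarith) (by linarith)
  have hsqrt1 := sqrt_div_add_ge (L := 2 * Real.log ((n : ℝ) + 1)) (by linarith) h1 hs0
  have hsqrt2 : √(2 * Real.log ((n : ℝ) + 1) / (N + s)) ≤
      √(2 * Real.log ((n : ℝ) + s + 1) / (N + s)) :=
    Real.sqrt_le_sqrt (by gcongr)
  have hlogdiff : Real.log ((n : ℝ) + s + 1) ≤ Real.log ((n : ℝ) + 1) + s / n := by
    have hx : ((n : ℝ) + s + 1) = (n + 1) * (1 + s / (n + 1)) := by field_simp; ring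
    rw [hx, Real.log_mul (by positivity) (by positivity)]
    have h2 := Real.log_le_sub_one_of_pos (show 0 < 1 + (s : ℝ) / (n + 1) by positivity)
    have h3 : (s : ℝ) / (n + 1) ≤ s / n := by gcongr; linarith
    linarith
  -- For `L ≥ 1` and `x ≥ 0` one has `√(L + x) ≤ √L + x`, which is how the growth of the logarithm
  -- is carried through the root in `hsqrt3`.
  have hlogone : 1 ≤ 2 * Real.log ((n : ℝ) + 1) := by
    have h2 : Real.log 2 ≤ Real.log ((n : ℝ) + 1) := Real.log_le_log (by norm_num) (by linarith)
    linarith [Real.log_two_gt_d9]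
  have hsqrt3 : √(2 * Real.log ((n : ℝ) + s + 1) / M) ≤
      √(2 * Real.log ((n : ℝ) + 1) / M) + 2 * s / n / √M := by
    rw [Real.sqrt_div (by linarith), Real.sqrt_div (by linarith), ← add_div]
    refine div_le_div_of_nonneg_right ?_ (Real.sqrt_nonneg _)
    refine Real.sqrt_le_iff.2 ⟨by positivity, ?_⟩
    have hone : 1 ≤ √(2 * Real.log ((n : ℝ) + 1)) := Real.one_le_sqrt.2 hlogone
    have hsq := Real.sq_sqrt (show 0 ≤ 2 * Real.log ((n : ℝ) + 1) by linarith)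
    have hpos : 0 ≤ 2 * (s : ℝ) / n := by positivity
    have : 2 * (s : ℝ) / n = 2 * (s / n) := by ring
    nlinarith
  -- Since `N ≤ n`, the growth of the bonus of arm one is negligible even after multiplication by
  -- `N`.
  have hprod : N * (2 * s / n / √M) ≤ 2 * s / √M := by
    have : N * (2 * s / n / √M) = N / n * (2 * s / √M) := by ring
    rw [this]
    exact mul_le_of_le_one_left (by positivity) (div_le_one_of_le₀ hN1n (by positivity))
  have hmain : N * ((S + j) / (N + s) - S / N) = N / (N + s) * (j - s * (S / N)) := by
    field_simp
    ring
  have hmul : N * ((S + j) / (N + s) - S / N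
      - √(2 * Real.log ((n : ℝ) + 1) / N) * s / (2 * N) - 2 * s / n / √M) ≤ 0 :=
    mul_nonpos_of_nonneg_of_nonpos h1.le (by linarith)
  have hexp : N * ((S + j) / (N + s) - S / N
      - √(2 * Real.log ((n : ℝ) + 1) / N) * s / (2 * N) - 2 * s / n / √M) =
      N * ((S + j) / (N + s) - S / N) - √(2 * Real.log ((n : ℝ) + 1) / N) * s / 2
        - N * (2 * s / n / √M) := by
    field_simp
  have hbs : √(2 * Real.log ((n : ℝ) + 1) / N) * s / 2 ≤ g n * s / 2 := by gcongr
  rw [hexp, hmain] at hmul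
  linarith

/-! ### Exploration episodes -/

lemma firstTime_eq_coe_iff {p : ℕ → Prop} {m : ℕ} :
    firstTime p = (m : ℕ∞) ↔ p m ∧ ∀ t < m, ¬ p t := by
  have hle : ∀ t, p t → firstTime p ≤ t := fun t ht => iInf₂_le t ht
  constructor
  · intro h
    have hlt : ∀ t < m, ¬ p t := fun t ht hp => by
      have := hle t hp
      rw [h] at this
      exact absurd ht (by exact_mod_cast not_lt.2 (Nat.cast_le.1 this))
    refine ⟨?_, hlt⟩
    by_contra hpm
    have : ((m + 1 : ℕ) : ℕ∞) ≤ firstTime p := le_iInf₂ fun t ht => by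
      have : ¬ t < m := fun h' => hlt t h' ht
      have : t ≠ m := fun h' => hpm (h' ▸ ht)
      exact_mod_cast (by omega : m + 1 ≤ t)
    rw [h] at this
    have := Nat.cast_le.1 this
    omega
  · rintro ⟨hpm, hlt⟩
    refine le_antisymm (hle m hpm) (le_iInf₂ fun t ht => ?_)
    exact_mod_cast not_lt.1 fun h' => hlt t h' ht

lemma firstTime_ne_top {p : ℕ → Prop} (h : ∃ t, p t) : firstTime p ≠ ⊤ := by
  obtain ⟨t, ht⟩ := h
  exact ne_top_of_le_ne_top (ENat.natCast_ne_top t) (iInf₂_le t ht)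

lemma explorationEpisode_zero_eq {a : ℕ → Fin 2} {m : ℕ} :
    explorationEpisode a 0 = (m : ℕ∞) ↔ (1 ≤ m ∧ a m = 1) ∧ ∀ t < m, ¬ (1 ≤ t ∧ a t = 1) := by
  rw [explorationEpisode, firstTime_eq_coe_iff]

lemma explorationEpisode_succ_eq {a : ℕ → Fin 2} {k m : ℕ} :
    explorationEpisode a (k + 1) = (m : ℕ∞) ↔
      (explorationEpisode a k < m ∧ a m = 1 ∧ a (m - 1) = 0) ∧
      ∀ t < m, ¬ (explorationEpisode a k < t ∧ a t = 1 ∧ a (t - 1) = 0) := by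
  rw [explorationEpisode, firstTime_eq_coe_iff]

/-- The bound `k + 1 ≤ m` turns "large `k`" into "late round". The first episode may start in round
1, with no pull of arm one before it, hence `0 < k`. -/
lemma explorationEpisode_eq_spec {a : ℕ → Fin 2} {k m : ℕ}
    (h : explorationEpisode a k = (m : ℕ∞)) :
    k + 1 ≤ m ∧ a m = 1 ∧ (0 < k → a (m - 1) = 0) := by
  induction k generalizing m with
  | zero =>
    obtain ⟨⟨h1, h2⟩, -⟩ := explorationEpisode_zero_eq.1 h
    exact ⟨by omega, h2, fun h0 => absurd h0 (lt_irrefl _)⟩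
  | succ k ih =>
    obtain ⟨⟨h1, h2, h3⟩, -⟩ := explorationEpisode_succ_eq.1 h
    obtain ⟨j, hj⟩ := ENat.ne_top_iff_exists.1 (ne_top_of_lt h1)
    have := (ih hj.symm).1
    rw [← hj] at h1
    have := Nat.cast_lt.1 h1
    exact ⟨by omega, h2, fun _ => h3⟩

/-- Episodes are stopping times: whether one starts in round `m` depends only on the arms up to `m`.
-/
lemma explorationEpisode_congr {a a' : ℕ → Fin 2} {k m : ℕ}
    (haa : ∀ t, 1 ≤ t → t ≤ m → a t = a' t) (h : explorationEpisode a k = (m : ℕ∞)) :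
    explorationEpisode a' k = (m : ℕ∞) := by
  induction k generalizing m with
  | zero =>
    rw [explorationEpisode_zero_eq] at h ⊢
    refine ⟨⟨h.1.1, ?_⟩, fun t ht hp => h.2 t ht ⟨hp.1, ?_⟩⟩
    · rw [← haa m h.1.1 le_rfl]; exact h.1.2
    · rw [haa t hp.1 ht.le]; exact hp.2
  | succ k ih =>
    have h' := explorationEpisode_succ_eq.1 h
    obtain ⟨⟨h1, h2, h3⟩, hmin⟩ := h'
    obtain ⟨j, hj⟩ := ENat.ne_top_iff_exists.1 (ne_top_of_lt h1)
    have hjm : j < m := by rw [← hj] at h1; exact Nat.cast_lt.1 h1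
    have hj1 := (explorationEpisode_eq_spec hj.symm).1
    have hj' := ih (fun t ht htm => haa t ht (by omega)) hj.symm
    rw [explorationEpisode_succ_eq, hj']
    rw [← hj] at h1 hmin
    refine ⟨⟨h1, ?_, ?_⟩, fun t ht hp => hmin t ht ⟨hp.1, ?_, ?_⟩⟩
    · rw [← haa m (by omega) le_rfl]; exact h2
    · rw [← haa (m - 1) (by omega) (by omega)]; exact h3
    · have : j < t := Nat.cast_lt.1 hp.1
      rw [haa t (by omega) ht.le]; exact hp.2.1
    · have : j < t := Nat.cast_lt.1 hp.1
      rw [haa (t - 1) (by omega) (by omega)]; exact hp.2.2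

lemma IsGreedy.exists_pull_gt {a : ℕ → Fin 2} {r : ℕ → Bool} (h : IsGreedy a r) (b : Fin 2)
    (n : ℕ) : ∃ t, n < t ∧ a t = b := by
  by_contra! hno
  have hconst : ∀ l ≥ n, visits a b l = visits a b n := by
    intro l hl
    induction l, hl using Nat.le_induction with
    | base => rfl
    | succ l hl ih => rw [visits_succ_of_ne (hno (l + 1) (by omega)), ih]
  obtain ⟨l, hl, hln⟩ :=
    (((h.tendsto_visits b).eventually_gt_atTop (visits a b n)).and (eventually_ge_atTop n)).exists
  rw [hconst l hln] at hl
  exact lt_irrefl _ hl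

lemma IsGreedy.explorationEpisode_ne_top {a : ℕ → Fin 2} {r : ℕ → Bool} (h : IsGreedy a r)
    (k : ℕ) : explorationEpisode a k ≠ ⊤ := by
  induction k with
  | zero =>
    obtain ⟨t, ht, hat⟩ := h.exists_pull_gt 1 0
    exact firstTime_ne_top ⟨t, ht, hat⟩
  | succ k ih =>
    obtain ⟨j, hj⟩ := ENat.ne_top_iff_exists.1 ih
    obtain ⟨t, ht, hat⟩ := h.exists_pull_gt 0 j
    have hex : ∃ u, t < u ∧ a u = 1 := h.exists_pull_gt 1 t
    classical
    obtain ⟨hu, hau⟩ := Nat.find_spec hex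
    have hmin := fun l => Nat.find_min (m := l) hex
    -- The first pull of arm two after a pull of arm one is itself preceded by a pull of arm one.
    set u := Nat.find hex
    refine firstTime_ne_top ⟨u, ?_, hau, ?_⟩
    · rw [← hj]; exact_mod_cast ht.trans hu
    · by_cases hut : u - 1 = t
      · rw [hut, hat]
      · have := hmin (u - 1) (by omega)
        have : a (u - 1) ≠ 1 := fun h' => this ⟨by omega, h'⟩
        omega

/-! ### The events of the `i`-th pull of an arm -/

section Pulls

variable {Ω : Type*} {A : ℕ → Ω → Fin 2} {R : ℕ → Ω → Bool}

/-- The event `G` is determined by the observations of the rounds `1, …, n` and the arm pulled in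
round `n + 1`. -/
def DeterminedAt (A : ℕ → Ω → Fin 2) (R : ℕ → Ω → Bool) (n : ℕ) (G : Set Ω) : Prop :=
  ∀ ω ω', (∀ t, 1 ≤ t → t ≤ n → A t ω = A t ω' ∧ R t ω = R t ω') →
    A (n + 1) ω = A (n + 1) ω' → ω ∈ G → ω' ∈ G

/-- The observations of the rounds `1, …, n` together with the arm of round `n + 1`. -/
def extendedHistory (A : ℕ → Ω → Fin 2) (R : ℕ → Ω → Bool) (n : ℕ) (ω : Ω) :
    History n × Fin 2 := (history A R n ω, A (n + 1) ω)

/-- Such an event is a union of fibres of a map into a finite type. This yields its measurability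
and reduces probabilities to single histories. -/
lemma DeterminedAt.preimage_image {n : ℕ} {G : Set Ω} (hG : DeterminedAt A R n G) :
    extendedHistory A R n ⁻¹' (extendedHistory A R n '' G) = G := by
  refine Set.Subset.antisymm ?_ (Set.subset_preimage_image _ _)
  rintro ω' ⟨ω, hω, he⟩
  obtain ⟨h1, h2⟩ := Prod.ext_iff.1 he
  refine hG ω ω' (fun t ht htn => ?_) h2 hω
  have := congrFun h1 ⟨t - 1, by omega⟩
  simp only [extendedHistory, history, Nat.sub_add_cancel ht] at this
  exact Prod.ext_iff.1 this

/-- The event that the pull of index `i` of arm `b` takes place in round `n + 1`. -/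
def pullAt (A : ℕ → Ω → Fin 2) (b : Fin 2) (i n : ℕ) : Set Ω :=
  {ω | A (n + 1) ω = b ∧ visits (fun t => A t ω) b n = i}

/-- The event that the pull of index `i` of arm `b` takes place and has reward one. -/
def successAt (A : ℕ → Ω → Fin 2) (R : ℕ → Ω → Bool) (b : Fin 2) (i : ℕ) : Set Ω :=
  ⋃ n, pullAt A b i n ∩ {ω | R (n + 1) ω = true}

lemma visits_congr {a a' : ℕ → Fin 2} {b : Fin 2} {n : ℕ}
    (h : ∀ t, 1 ≤ t → t ≤ n → a t = a' t) : visits a b n = visits a' b n := by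
  induction n with
  | zero => simp
  | succ n ih =>
    have := h (n + 1) (by omega) le_rfl
    simp only [visits, Nat.count_succ] at ih ⊢
    rw [ih fun t ht htn => h t ht (by omega), this]

lemma determinedAt_pullAt (b : Fin 2) (i n : ℕ) : DeterminedAt A R n (pullAt A b i n) := by
  rintro ω ω' h1 h2 ⟨h3, h4⟩
  exact ⟨h2 ▸ h3, (visits_congr fun t ht htn => (h1 t ht htn).1) ▸ h4⟩

lemma pullAt_unique {b : Fin 2} {i m n : ℕ} {ω : Ω} (hm : ω ∈ pullAt A b i m)
    (hn : ω ∈ pullAt A b i n) : m = n :=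
  Nat.count_injective hm.1 hn.1 (hm.2.trans hn.2.symm)

lemma pullAt_lt {b : Fin 2} {i j m n : ℕ} (hij : i < j) {ω : Ω} (hm : ω ∈ pullAt A b i m)
    (hn : ω ∈ pullAt A b j n) : m < n := by
  by_contra hnm
  have := Nat.count_monotone (fun t => A (t + 1) ω = b) (not_lt.1 hnm)
  have h1 := hm.2
  have h2 := hn.2
  simp only [visits] at h1 h2
  omega

lemma successes_eq_sum_indicator (b : Fin 2) (n : ℕ) (ω : Ω) :
    (successes (fun t => A t ω) (fun t => R t ω) b n : ℝ) =
      ∑ i ∈ Finset.range (visits (fun t => A t ω) b n),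
        (successAt A R b i).indicator (fun _ => (1 : ℝ)) ω := by
  classical
  induction n with
  | zero => simp
  | succ n ih =>
    by_cases hn : A (n + 1) ω = b
    · rw [successes_succ_of_eq (a := fun t => A t ω) hn, visits_succ_of_eq (a := fun t => A t ω) hn,
        Finset.sum_range_succ, ← ih, Nat.cast_add, Set.indicator_apply]
      have hmem : ω ∈ successAt A R b (visits (fun t => A t ω) b n) ↔ R (n + 1) ω = true := by
        rw [successAt, Set.mem_iUnion]
        constructor
        · rintro ⟨m, hm, hr⟩
          have : m = n := pullAt_unique hm ⟨hn, rfl⟩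
          exact this ▸ hr
        · exact fun hr => ⟨n, ⟨hn, rfl⟩, hr⟩
      simp only [hmem]
      split_ifs <;> simp
    · rw [successes_succ_of_ne (a := fun t => A t ω) hn, visits_succ_of_ne (a := fun t => A t ω) hn,
        ih]

end Pulls

lemma IsGreedy.exists_visits_eq {a : ℕ → Fin 2} {r : ℕ → Bool} (h : IsGreedy a r) (b : Fin 2)
    (i : ℕ) : ∃ n, a (n + 1) = b ∧ visits a b n = i := by
  have hinf : (Set.ofPred fun t => a (t + 1) = b).Infinite := by
    rw [Set.infinite_iff_exists_gt]
    intro n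
    obtain ⟨t, ht, hat⟩ := h.exists_pull_gt b (n + 1)
    refine ⟨t - 1, ?_, by omega⟩
    change a (t - 1 + 1) = b
    rwa [Nat.sub_add_cancel (by omega)]
  exact ⟨Nat.nth (fun t => a (t + 1) = b) i, Nat.nth_mem_of_infinite hinf i,
    Nat.count_nth fun hf => absurd hf hinf⟩

/-! ### The strong Markov property of a run -/

section Run

variable {Ω : Type*} [MeasurableSpace Ω] {P : Measure Ω} {μ : Fin 2 → unitInterval} {π : Policy}
  {A : ℕ → Ω → Fin 2} {R : ℕ → Ω → Bool}

lemma IsRun.measurable_extendedHistory (h : IsRun P μ π A R) (n : ℕ) :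
    Measurable (extendedHistory A R n) :=
  (measurable_pi_iff.2 fun _ => (h.measurable_arm _).prodMk (h.measurable_reward _)).prodMk
    (h.measurable_arm _)

lemma IsRun.measurableSet_of_determinedAt (h : IsRun P μ π A R) {n : ℕ} {G : Set Ω}
    (hG : DeterminedAt A R n G) : MeasurableSet G := by
  rw [← hG.preimage_image]
  exact h.measurable_extendedHistory n (Set.to_countable _).measurableSet

lemma IsRun.measurableSet_reward (h : IsRun P μ π A R) (n : ℕ) (r : Bool) :
    MeasurableSet {ω | R n ω = r} :=
  h.measurable_reward n (measurableSet_singleton r)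

lemma IsRun.measure_extendedHistory_inter (h : IsRun P μ π A R) (n : ℕ) (z : History n × Fin 2)
    (r : Bool) : P (extendedHistory A R n ⁻¹' {z} ∩ {ω | R (n + 1) ω = r}) =
      P (extendedHistory A R n ⁻¹' {z}) * bernoulliMeasure true false (μ z.2) {r} := by
  have hlaw : ∀ r, P (extendedHistory A R n ⁻¹' {z} ∩ {ω | R (n + 1) ω = r}) =
      P {ω | history A R n ω = z.1} * π n z.1 z.2 * bernoulliMeasure true false (μ z.2) {r} := by
    intro r
    rw [← h.law]
    congr 1
    ext ω
    simp [extendedHistory, Prod.ext_iff, and_assoc]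
  have hsum : P (extendedHistory A R n ⁻¹' {z}) = P {ω | history A R n ω = z.1} * π n z.1 z.2 := by
    rw [← measure_inter_add_sdiff _ (h.measurableSet_reward (n + 1) true)]
    have hdiff : extendedHistory A R n ⁻¹' {z} \ {ω | R (n + 1) ω = true} =
        extendedHistory A R n ⁻¹' {z} ∩ {ω | R (n + 1) ω = false} := by
      ext ω; simp
    have hone : bernoulliMeasure true false (μ z.2) {true} +
        bernoulliMeasure true false (μ z.2) {false} = 1 := by
      rw [← measure_union (by simp) (measurableSet_singleton _),
        ← measure_univ (μ := bernoulliMeasure true false (μ z.2))]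
      congr 1
      ext r
      cases r <;> simp
    rw [hdiff, hlaw, hlaw, ← mul_add, hone, mul_one]
  rw [hlaw, hsum]

lemma IsRun.measure_inter_reward (h : IsRun P μ π A R) {n : ℕ} {G : Set Ω}
    (hG : DeterminedAt A R n G) {b : Fin 2} (hGb : ∀ ω ∈ G, A (n + 1) ω = b) (r : Bool) :
    P (G ∩ {ω | R (n + 1) ω = r}) = P G * bernoulliMeasure true false (μ b) {r} := by
  classical
  have hsum : ∀ Q : Measure Ω, Q G =
      ∑ z ∈ (extendedHistory A R n '' G).toFinite.toFinset, Q (extendedHistory A R n ⁻¹' {z}) := by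
    intro Q
    rw [sum_measure_preimage_singleton _ fun z _ =>
      h.measurable_extendedHistory n (measurableSet_singleton z)]
    rw [Set.Finite.coe_toFinset, hG.preimage_image]
  rw [← Measure.restrict_apply (h.measurableSet_of_determinedAt hG), hsum, hsum P,
    Finset.sum_mul]
  refine Finset.sum_congr rfl fun z hz => ?_
  rw [Measure.restrict_apply (h.measurable_extendedHistory n (measurableSet_singleton z)),
    h.measure_extendedHistory_inter]
  obtain ⟨ω, hω, rfl⟩ := (Set.Finite.mem_toFinset _).1 hz
  rw [show (extendedHistory A R n ω).2 = b from hGb ω hω]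

/-- Strong Markov property: at a random round of pulling arm `b` that is recognized without looking
at its reward, the reward is Bernoulli and independent of the past. -/
lemma IsRun.measure_iUnion_inter_reward (h : IsRun P μ π A R) {G : ℕ → Set Ω}
    (hG : ∀ n, DeterminedAt A R n (G n)) (hdisj : ∀ ω m n, ω ∈ G m → ω ∈ G n → m = n) {b : Fin 2}
    (hGb : ∀ n, ∀ ω ∈ G n, A (n + 1) ω = b) (r : Bool) :
    P (⋃ n, G n ∩ {ω | R (n + 1) ω = r}) =
      P (⋃ n, G n) * bernoulliMeasure true false (μ b) {r} := by
  have hd : Pairwise (Function.onFun Disjoint G) := fun m n hmn =>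
    Set.disjoint_left.2 fun ω h1 h2 => hmn (hdisj ω m n h1 h2)
  have hmeas := fun n => h.measurableSet_of_determinedAt (hG n)
  rw [measure_iUnion (fun m n hmn => (hd hmn).mono Set.inter_subset_left Set.inter_subset_left)
    (fun n => (hmeas n).inter (h.measurableSet_reward _ _)), measure_iUnion hd hmeas,
    ← ENNReal.tsum_mul_right]
  exact tsum_congr fun n => h.measure_inter_reward (hG n) (hGb n) r

/-- The condition on `π` only concerns arms of positive probability; the other choices form a
countable union of null events. -/
lemma IsRun.ae_ucbIndex_le (h : IsRun P μ π A R) (hπ : IsUCB π) :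
    ∀ᵐ ω ∂P, ∀ n b, ucbIndex (history A R n ω) b ≤ ucbIndex (history A R n ω) (A (n + 1) ω) := by
  have hnull : ∀ᵐ ω ∂P, ∀ (n : ℕ) (x : History n × Fin 2 × Bool), π n x.1 x.2.1 = 0 →
      ¬ (history A R n ω = x.1 ∧ A (n + 1) ω = x.2.1 ∧ R (n + 1) ω = x.2.2) := by
    rw [ae_all_iff]
    intro n
    rw [ae_all_iff]
    intro x
    by_cases hx : π n x.1 x.2.1 = 0
    · have := h.law n x.1 x.2.1 x.2.2
      rw [hx, mul_zero, zero_mul] at this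
      filter_upwards [measure_eq_zero_iff_ae_notMem.1 this] with ω hω _
      exact hω
    · exact Eventually.of_forall fun ω h0 => absurd h0 hx
  filter_upwards [hnull] with ω hω n b
  exact hπ n _ _ (fun h0 => hω n (history A R n ω, A (n + 1) ω, R (n + 1) ω) h0 ⟨rfl, rfl, rfl⟩) b

lemma IsRun.ae_isGreedy (h : IsRun P μ π A R) (hπ : IsUCB π) :
    ∀ᵐ ω ∂P, IsGreedy (fun t => A t ω) (fun t => R t ω) := by
  filter_upwards [h.ae_ucbIndex_le hπ] with ω hω
  exact isGreedy_of_ucbIndex_le A R ω hω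

/-! ### The law of large numbers for the empirical means -/

lemma IsRun.measurableSet_successAt (h : IsRun P μ π A R) (b : Fin 2) (i : ℕ) :
    MeasurableSet (successAt A R b i) :=
  MeasurableSet.iUnion fun n => (h.measurableSet_of_determinedAt (determinedAt_pullAt b i n)).inter
    (h.measurableSet_reward _ _)

lemma IsRun.ae_mem_iUnion_pullAt (h : IsRun P μ π A R) (hπ : IsUCB π) (b : Fin 2) (i : ℕ) :
    ∀ᵐ ω ∂P, ω ∈ ⋃ n, pullAt A b i n := by
  filter_upwards [h.ae_isGreedy hπ] with ω hω
  obtain ⟨n, hn⟩ := hω.exists_visits_eq b i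
  exact Set.mem_iUnion.2 ⟨n, hn⟩

lemma IsRun.measure_successAt [IsProbabilityMeasure P] (h : IsRun P μ π A R) (hπ : IsUCB π)
    (b : Fin 2) (i : ℕ) :
    P (successAt A R b i) = bernoulliMeasure true false (μ b) {true} := by
  rw [successAt, h.measure_iUnion_inter_reward (determinedAt_pullAt b i)
    (fun ω m n => pullAt_unique) (fun n ω hω => hω.1),
    (prob_compl_eq_zero_iff₀ ?_).1, one_mul]
  · exact h.ae_mem_iUnion_pullAt hπ b i
  · exact (MeasurableSet.iUnion fun n =>
      h.measurableSet_of_determinedAt (determinedAt_pullAt b i n)).nullMeasurableSet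

lemma IsRun.measure_successAt_inter [IsProbabilityMeasure P] (h : IsRun P μ π A R) (hπ : IsUCB π)
    (b : Fin 2) {i j : ℕ} (hij : i < j) :
    P (successAt A R b i ∩ successAt A R b j) =
      P (successAt A R b i) * P (successAt A R b j) := by
  -- The reward of pull `i` is known when pull `j` is made, so the strong Markov property applies to
  -- pull `j` on this event.
  let G : ℕ → Set Ω := fun n => pullAt A b j n ∩ ⋃ m, ⋃ (_ : m < n),
    pullAt A b i m ∩ {ω | R (m + 1) ω = true}
  have hG : ∀ n, DeterminedAt A R n (G n) := by
    rintro n ω ω' h1 h2 ⟨h3, h4⟩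
    refine ⟨determinedAt_pullAt b j n ω ω' h1 h2 h3, ?_⟩
    simp only [Set.mem_iUnion] at h4 ⊢
    obtain ⟨m, hmn, h5, h6⟩ := h4
    refine ⟨m, hmn, determinedAt_pullAt (R := R) b i m ω ω' (fun t ht htm => h1 t ht (by omega))
      (h1 (m + 1) (by omega) (by omega)).1 h5, ?_⟩
    exact (h1 (m + 1) (by omega) (by omega)).2.symm.trans h6
  have h1 : successAt A R b i ∩ successAt A R b j = ⋃ n, G n ∩ {ω | R (n + 1) ω = true} := by
    ext ω
    simp only [successAt, G, Set.mem_inter_iff, Set.mem_iUnion]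
    constructor
    · rintro ⟨⟨m, hm⟩, n, hn⟩
      exact ⟨n, ⟨hn.1, m, pullAt_lt hij hm.1 hn.1, hm⟩, hn.2⟩
    · rintro ⟨n, ⟨hn, m, -, hm⟩, hr⟩
      exact ⟨⟨m, hm⟩, n, hn, hr⟩
  have h2 : P (⋃ n, G n) = P (successAt A R b i) := by
    refine measure_congr ?_
    filter_upwards [h.ae_mem_iUnion_pullAt hπ b j] with ω hω
    obtain ⟨n, hn⟩ := Set.mem_iUnion.1 hω
    refine propext ⟨fun hg => ?_, fun hs => ?_⟩
    · obtain ⟨n, -, hg⟩ := Set.mem_iUnion.1 hg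
      simp only [Set.mem_iUnion] at hg
      obtain ⟨m, -, hm⟩ := hg
      exact Set.mem_iUnion.2 ⟨m, hm⟩
    · obtain ⟨m, hm⟩ := Set.mem_iUnion.1 hs
      refine Set.mem_iUnion.2 ⟨n, hn, ?_⟩
      simp only [Set.mem_iUnion]
      exact ⟨m, pullAt_lt hij hm.1 hn, hm⟩
  rw [h1, h.measure_iUnion_inter_reward hG (fun ω m n hm hn => pullAt_unique hm.1 hn.1)
    (fun n ω hω => hω.1.1), h2, h.measure_successAt hπ b j]

end Run

lemma indepFun_indicator_one {Ω : Type*} [MeasurableSpace Ω] {P : Measure Ω}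
    [IsProbabilityMeasure P] {s t : Set Ω} (hs : MeasurableSet s) (ht : MeasurableSet t)
    (hst : P (s ∩ t) = P s * P t) :
    IndepFun (s.indicator fun _ => (1 : ℝ)) (t.indicator fun _ => (1 : ℝ)) P := by
  have hind : IndepSet s t P := (indepSet_iff_measure_inter_eq_mul hs ht P).2 hst
  rw [IndepSet_iff_Indep] at hind
  rw [IndepFun_iff_Indep]
  refine indep_of_indep_of_le_left (indep_of_indep_of_le_right hind ?_) ?_
  all_goals
    refine Measurable.comap_le ?_
    exact Measurable.indicator measurable_const
      (MeasurableSpace.measurableSet_generateFrom (Set.mem_singleton _))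

lemma identDistrib_indicator_one {Ω : Type*} [MeasurableSpace Ω] {P : Measure Ω}
    [IsProbabilityMeasure P] {s t : Set Ω} (hs : MeasurableSet s) (ht : MeasurableSet t)
    (hst : P s = P t) :
    IdentDistrib (s.indicator fun _ => (1 : ℝ)) (t.indicator fun _ => (1 : ℝ)) P P := by
  have ms : Measurable (s.indicator fun _ => (1 : ℝ)) := measurable_const.indicator hs
  have mt : Measurable (t.indicator fun _ => (1 : ℝ)) := measurable_const.indicator ht
  refine ⟨ms.aemeasurable, mt.aemeasurable, ?_⟩
  classical
  ext u hu
  rw [Measure.map_apply ms hu, Measure.map_apply mt hu]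
  simp only [Set.indicator_const_preimage_eq_union]
  split_ifs <;> simp [hst, prob_compl_eq_one_sub hs, prob_compl_eq_one_sub ht]

lemma bernoulliMeasure_true_toReal (p : unitInterval) :
    (bernoulliMeasure true false p {true}).toReal = p := by
  rw [← measureReal_def, bernoulliMeasure_real_apply_of_mem_of_notMem] <;> simp

lemma IsRun.ae_meansConverge {Ω : Type*} [MeasurableSpace Ω] {P : Measure Ω}
    [IsProbabilityMeasure P] {μ : Fin 2 → unitInterval} {π : Policy}
    {A : ℕ → Ω → Fin 2} {R : ℕ → Ω → Bool} (h : IsRun P μ π A R) (hπ : IsUCB π) :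
    ∀ᵐ ω ∂P, MeansConverge (fun t => A t ω) (fun t => R t ω) (fun b => (μ b : ℝ)) := by
  have hslln : ∀ᵐ ω ∂P, ∀ b, Tendsto (fun n : ℕ => (∑ i ∈ Finset.range n,
      (successAt A R b i).indicator (fun _ => (1 : ℝ)) ω) / n) atTop (nhds (μ b : ℝ)) := by
    rw [ae_all_iff]
    intro b
    have hmeas := h.measurableSet_successAt b
    -- Etemadi's form of the strong law needs only pairwise independence.
    have hlim := strong_law_ae_real (μ := P)
      (fun i => (successAt A R b i).indicator fun _ => (1 : ℝ))
      ((integrable_const _).indicator (hmeas 0)) ?_ fun i => identDistrib_indicator_one (hmeas i)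
        (hmeas 0) (by rw [h.measure_successAt hπ, h.measure_successAt hπ])
    · have hint : ∫ ω, (successAt A R b 0).indicator (fun _ => (1 : ℝ)) ω ∂P = μ b := by
        rw [integral_indicator_const _ (hmeas 0), measureReal_def, h.measure_successAt hπ,
          bernoulliMeasure_true_toReal, smul_eq_mul, mul_one]
      rw [hint] at hlim
      exact hlim
    · intro i j hij
      rcases lt_or_gt_of_ne hij with hlt | hlt
      · exact indepFun_indicator_one (hmeas i) (hmeas j) (h.measure_successAt_inter hπ b hlt)
      · exact (indepFun_indicator_one (hmeas j) (hmeas i)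
          (h.measure_successAt_inter hπ b hlt)).symm
  filter_upwards [hslln, h.ae_isGreedy hπ] with ω hω hg b
  refine ((hω b).comp (hg.tendsto_visits b)).congr fun n => ?_
  rw [successes_eq_sum_indicator]
  rfl

/-! ### Reward words observed at the start of an exploration episode -/

/-- All nonempty prefixes of length at most `s` of the word `w` of rewards have an average that
exceeds `m₂` by more than half the gap. -/
def IsOptimisticWord (m₁ m₂ : ℝ) (w : ℕ → Bool) (s : ℕ) : Prop :=
  ∀ t, 1 ≤ t → t ≤ s →
    0 < (Nat.count (fun i => w i = true) t : ℝ) - t * m₂ - t * (m₁ - m₂) / 2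

/-- The infinite word that extends a finite one by `false`. -/
def extendWord {s : ℕ} (w : Fin s → Bool) (i : ℕ) : Bool := if h : i < s then w ⟨i, h⟩ else false

lemma extendWord_apply {s : ℕ} (w : Fin s → Bool) (i : Fin s) : extendWord w i = w i := by
  simp [extendWord]

open Classical in
/-- The finite set of optimistic words of length `s`. -/
def optimisticWords (m₁ m₂ : ℝ) (s : ℕ) : Finset (Fin s → Bool) :=
  Finset.univ.filter fun w => IsOptimisticWord m₁ m₂ (extendWord w) s

lemma mem_optimisticWords {m₁ m₂ : ℝ} {s : ℕ} {w : Fin s → Bool} :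
    w ∈ optimisticWords m₁ m₂ s ↔ IsOptimisticWord m₁ m₂ (extendWord w) s := by
  simp [optimisticWords]

section Pulls

variable {Ω : Type*} {A : ℕ → Ω → Fin 2} {R : ℕ → Ω → Bool}

/-- The episode of index `k` starts with `s` pulls of arm two, with rewards given by `w`. -/
def streakEvent (A : ℕ → Ω → Fin 2) (R : ℕ → Ω → Bool) (k : ℕ) (w : ℕ → Bool) (s : ℕ) : Set Ω :=
  {ω | ∃ m : ℕ, explorationEpisode (fun t => A t ω) k = m ∧
    ∀ i < s, A (m + i) ω = 1 ∧ R (m + i) ω = w i}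

/-- The episode of index `k` starts with `s` pulls of arm two, with rewards given by `w`, followed
by another pull of arm two in round `n + 1`. -/
def streakPullAt (A : ℕ → Ω → Fin 2) (R : ℕ → Ω → Bool) (k : ℕ) (w : ℕ → Bool) (s n : ℕ) : Set Ω :=
  {ω | ∃ m : ℕ, explorationEpisode (fun t => A t ω) k = m ∧ m + s = n + 1 ∧
    (∀ i < s, A (m + i) ω = 1 ∧ R (m + i) ω = w i) ∧ A (n + 1) ω = 1}

/-- The episode of index `k` happens and arm two is pulled `s` rounds after its start, in round
`n + 1`. -/
def windowPullAt (A : ℕ → Ω → Fin 2) (k s n : ℕ) : Set Ω :=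
  {ω | ∃ m : ℕ, explorationEpisode (fun t => A t ω) k = m ∧ m + s = n + 1 ∧ A (n + 1) ω = 1}

lemma explorationEpisode_congr_of_agree {ω ω' : Ω} {k m n : ℕ}
    (h1 : ∀ t, 1 ≤ t → t ≤ n → A t ω = A t ω' ∧ R t ω = R t ω')
    (h2 : A (n + 1) ω = A (n + 1) ω') (hm : m ≤ n + 1)
    (h : explorationEpisode (fun t => A t ω) k = m) :
    explorationEpisode (fun t => A t ω') k = m := by
  refine explorationEpisode_congr (fun t ht htm => ?_) h
  rcases Nat.lt_or_ge n t with htn | htn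
  · rw [show t = n + 1 by omega]; exact h2
  · exact (h1 t ht htn).1

lemma determinedAt_streakPullAt (k : ℕ) (w : ℕ → Bool) (s n : ℕ) :
    DeterminedAt A R n (streakPullAt A R k w s n) := by
  rintro ω ω' h1 h2 ⟨m, hm, hmn, hw, hA⟩
  have := (explorationEpisode_eq_spec hm).1
  refine ⟨m, explorationEpisode_congr_of_agree h1 h2 (by omega) hm, hmn, fun i hi => ?_, h2 ▸ hA⟩
  obtain ⟨h3, h4⟩ := h1 (m + i) (by omega) (by omega)
  rw [← h3, ← h4]
  exact hw i hi

lemma determinedAt_windowPullAt (R : ℕ → Ω → Bool) (k s n : ℕ) :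
    DeterminedAt A R n (windowPullAt A k s n) := by
  rintro ω ω' h1 h2 ⟨m, hm, hmn, hA⟩
  exact ⟨m, explorationEpisode_congr_of_agree h1 h2 (by omega) hm, hmn, h2 ▸ hA⟩

lemma streakPullAt_unique {k : ℕ} {w : ℕ → Bool} {s n n' : ℕ} {ω : Ω}
    (h : ω ∈ streakPullAt A R k w s n) (h' : ω ∈ streakPullAt A R k w s n') : n = n' := by
  obtain ⟨m, hm, hmn, -⟩ := h
  obtain ⟨m', hm', hmn', -⟩ := h'
  have : m = m' := Nat.cast_injective (hm.symm.trans hm')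
  omega

lemma mem_iUnion_streakPullAt {k : ℕ} {w : ℕ → Bool} {s : ℕ} {ω : Ω} :
    ω ∈ ⋃ n, streakPullAt A R k w s n ↔
      ∃ m : ℕ, explorationEpisode (fun t => A t ω) k = m ∧
        (∀ i < s, A (m + i) ω = 1 ∧ R (m + i) ω = w i) ∧ A (m + s) ω = 1 := by
  rw [Set.mem_iUnion]
  constructor
  · rintro ⟨n, m, hm, hmn, hw, hA⟩
    exact ⟨m, hm, hw, hmn ▸ hA⟩
  · rintro ⟨m, hm, hw, hA⟩
    have := (explorationEpisode_eq_spec hm).1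
    have hn : m + s = m + s - 1 + 1 := by omega
    exact ⟨m + s - 1, m, hm, hn, hw, hn ▸ hA⟩

lemma mem_iUnion_windowPullAt {k s : ℕ} {ω : Ω} :
    ω ∈ ⋃ n, windowPullAt A k s n ↔
      ∃ m : ℕ, explorationEpisode (fun t => A t ω) k = m ∧ A (m + s) ω = 1 := by
  rw [Set.mem_iUnion]
  constructor
  · rintro ⟨n, m, hm, hmn, hA⟩
    exact ⟨m, hm, hmn ▸ hA⟩
  · rintro ⟨m, hm, hA⟩
    have := (explorationEpisode_eq_spec hm).1
    have hn : m + s = m + s - 1 + 1 := by omega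
    exact ⟨m + s - 1, m, hm, hn, hn ▸ hA⟩

lemma iUnion_streakPullAt_subset (k : ℕ) (w : ℕ → Bool) (s : ℕ) :
    ⋃ n, streakPullAt A R k w s n ⊆ streakEvent A R k w s := by
  intro ω hω
  obtain ⟨m, hm, hw, -⟩ := mem_iUnion_streakPullAt.1 hω
  exact ⟨m, hm, hw⟩

lemma streakEvent_zero (k : ℕ) (w : ℕ → Bool) :
    streakEvent A R k w 0 = ⋃ n, streakPullAt A R k w 0 n := by
  refine (Set.Subset.antisymm ?_ (iUnion_streakPullAt_subset k w 0))
  rintro ω ⟨m, hm, hw⟩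
  exact mem_iUnion_streakPullAt.2 ⟨m, hm, hw, (explorationEpisode_eq_spec hm).2.1⟩

lemma streakEvent_succ (k : ℕ) (w : ℕ → Bool) (s : ℕ) :
    streakEvent A R k w (s + 1) = ⋃ n, streakPullAt A R k w s n ∩ {ω | R (n + 1) ω = w s} := by
  ext ω
  rw [Set.mem_iUnion]
  constructor
  · rintro ⟨m, hm, hw⟩
    have := (explorationEpisode_eq_spec hm).1
    have hn : m + s = m + s - 1 + 1 := by omega
    have hs := hw s (by omega)
    exact ⟨m + s - 1, ⟨m, hm, hn, fun i hi => hw i (by omega), hn ▸ hs.1⟩, hn ▸ hs.2⟩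
  · rintro ⟨n, ⟨m, hm, hmn, hw, hA⟩, hR⟩
    refine ⟨m, hm, fun i hi => ?_⟩
    rcases Nat.lt_or_ge i s with his | his
    · exact hw i his
    · rw [show i = s by omega, hmn]
      exact ⟨hA, hR⟩

lemma count_congr_of_lt {p q : ℕ → Prop} [DecidablePred p] [DecidablePred q] {s : ℕ}
    (h : ∀ i < s, (p i ↔ q i)) : Nat.count p s = Nat.count q s := by
  rw [Nat.count_eq_card_filter_range, Nat.count_eq_card_filter_range]
  congr 1
  exact Finset.filter_congr fun i hi => h i (Finset.mem_range.1 hi)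

lemma explorationRegret_eq_sum (μ : Fin 2 → unitInterval) (k T : ℕ) (ω : Ω) :
    explorationRegret μ (fun t => A t ω) k T = ∑ s ∈ Finset.range T,
      (⋃ n, windowPullAt A k s n).indicator (fun _ => (μ 0 : ℝ) - μ 1) ω := by
  classical
  rw [explorationRegret]
  split_ifs with htop
  · refine (Finset.sum_eq_zero fun s _ => Set.indicator_of_notMem (fun hω => ?_) _).symm
    obtain ⟨m, hm, -⟩ := mem_iUnion_windowPullAt.1 hω
    exact ENat.natCast_ne_top m (hm.symm.trans htop)
  · obtain ⟨m, hm⟩ := ENat.ne_top_iff_exists.1 htop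
    rw [← hm, ENat.toNat_natCast, pseudoRegret]
    have hT : (T : ℝ) * (μ 0 : ℝ) = ∑ s ∈ Finset.range T, (μ 0 : ℝ) := by simp
    rw [hT, ← Finset.sum_sub_distrib]
    refine Finset.sum_congr rfl fun s _ => ?_
    have hmem : ω ∈ ⋃ n, windowPullAt A k s n ↔ A (m + s) ω = 1 := by
      rw [mem_iUnion_windowPullAt]
      constructor
      · rintro ⟨m', hm', hA⟩
        obtain rfl : m = m' := Nat.cast_injective (hm.trans hm')
        exact hA
      · exact fun hA => ⟨m, hm.symm, hA⟩
    rw [Set.indicator_apply]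
    by_cases hA : A (m + s) ω = 1
    · rw [if_pos (hmem.2 hA), hA]
    · rw [if_neg (fun h' => hA (hmem.1 h')), show A (m + s) ω = 0 by omega, sub_self]

end Pulls

/-! ### Limiting law of the rewards in an initial streak -/

section Run

variable {Ω : Type*} [MeasurableSpace Ω] {P : Measure Ω} {μ : Fin 2 → unitInterval} {π : Policy}
  {A : ℕ → Ω → Fin 2} {R : ℕ → Ω → Bool}

lemma IsRun.measurableSet_iUnion_streakPullAt (h : IsRun P μ π A R) (k : ℕ) (w : ℕ → Bool)
    (s : ℕ) : MeasurableSet (⋃ n, streakPullAt A R k w s n) :=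
  MeasurableSet.iUnion fun n => h.measurableSet_of_determinedAt (determinedAt_streakPullAt k w s n)

lemma IsRun.measurableSet_iUnion_windowPullAt (h : IsRun P μ π A R) (k s : ℕ) :
    MeasurableSet (⋃ n, windowPullAt A k s n) :=
  MeasurableSet.iUnion fun n => h.measurableSet_of_determinedAt (determinedAt_windowPullAt R k s n)

lemma IsRun.measurableSet_streakEvent (h : IsRun P μ π A R) (k : ℕ) (w : ℕ → Bool) (s : ℕ) :
    MeasurableSet (streakEvent A R k w s) := by
  cases s with
  | zero =>
    rw [streakEvent_zero]
    exact h.measurableSet_iUnion_streakPullAt k w 0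
  | succ s =>
    rw [streakEvent_succ]
    exact MeasurableSet.iUnion fun n =>
      (h.measurableSet_of_determinedAt (determinedAt_streakPullAt k w s n)).inter
        (h.measurableSet_reward _ _)

lemma IsRun.ae_explorationEpisode_ne_top (h : IsRun P μ π A R) (hπ : IsUCB π) (k : ℕ) :
    ∀ᵐ ω ∂P, explorationEpisode (fun t => A t ω) k ≠ ⊤ := by
  filter_upwards [h.ae_isGreedy hπ] with ω hω
  exact hω.explorationEpisode_ne_top k

lemma IsRun.real_streakEvent_succ (h : IsRun P μ π A R) (k : ℕ) (w : ℕ → Bool) (s : ℕ) :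
    P.real (streakEvent A R k w (s + 1)) =
      P.real (⋃ n, streakPullAt A R k w s n) * (bernoulliMeasure true false (μ 1)).real {w s} := by
  rw [streakEvent_succ, measureReal_def, h.measure_iUnion_inter_reward
    (determinedAt_streakPullAt k w s) (fun ω m n => streakPullAt_unique)
    (fun n ω ⟨_, _, _, _, hA⟩ => hA), ENNReal.toReal_mul]
  rfl

variable [IsProbabilityMeasure P]

lemma IsRun.real_streakEvent_zero (h : IsRun P μ π A R) (hπ : IsUCB π) (k : ℕ) (w : ℕ → Bool) :
    P.real (streakEvent A R k w 0) = 1 := by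
  have : P (streakEvent A R k w 0) = 1 := by
    refine (mem_ae_iff_prob_eq_one (h.measurableSet_streakEvent k w 0)).1 ?_
    filter_upwards [h.ae_explorationEpisode_ne_top hπ k] with ω hω
    obtain ⟨m, hm⟩ := ENat.ne_top_iff_exists.1 hω
    exact ⟨m, hm.symm, fun i hi => absurd hi (Nat.not_lt_zero i)⟩
  rw [measureReal_def, this, ENNReal.toReal_one]

/-- Almost every trajectory lies in only finitely many of these events, by
`IsGreedy.streak_continues`, so the indicators tend to 0 and dominated convergence applies. For `s =
0` the events are empty, since an episode starts with a pull of arm two. -/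
lemma IsRun.tendsto_real_streak_stops (h : IsRun P μ π A R) (hπ : IsUCB π)
    (hμ : (μ 1 : ℝ) < μ 0) {w : ℕ → Bool} {s : ℕ} (hw : IsOptimisticWord (μ 0) (μ 1) w s) :
    Tendsto (fun k => P.real (streakEvent A R k w s \ ⋃ n, streakPullAt A R k w s n)) atTop
      (nhds 0) := by
  rcases Nat.eq_zero_or_pos s with rfl | hs
  · simp [streakEvent_zero]
  have hlim : Tendsto (fun k => P (streakEvent A R k w s \ ⋃ n, streakPullAt A R k w s n)) atTop
      (nhds (P ∅)) := by
    refine tendsto_measure_of_ae_tendsto_indicator_of_isFiniteMeasure atTop MeasurableSet.empty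
      (fun k => (h.measurableSet_streakEvent k w s).diff
        (h.measurableSet_iUnion_streakPullAt k w s)) ?_
    filter_upwards [h.ae_isGreedy hπ, h.ae_meansConverge hπ] with ω hg hm
    obtain ⟨n₀, hn₀⟩ := eventually_atTop.1
      (hg.streak_continues hm hμ s (Nat.count (fun i => w i = true) s) (hw s hs le_rfl))
    filter_upwards [eventually_ge_atTop n₀, eventually_gt_atTop 0] with k hk hk0
    simp only [Set.mem_empty_iff_false, iff_false]
    rintro ⟨⟨m, hm, hstreak⟩, hnot⟩
    obtain ⟨h1, h2, h3⟩ := explorationEpisode_eq_spec hm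
    have hm1 : m - 1 + 1 = m := by omega
    refine hnot (mem_iUnion_streakPullAt.2 ⟨m, hm, hstreak, ?_⟩)
    have := hn₀ (m - 1) (by omega) (h3 hk0)
    simp only [hm1] at this
    refine this h2 (fun i hi => (hstreak i hi).1) (count_congr_of_lt fun i hi => ?_)
    rw [(hstreak i hi).2]
  rw [measure_empty] at hlim
  exact (ENNReal.tendsto_toReal ENNReal.zero_ne_top).comp hlim

lemma IsRun.tendsto_real_iUnion_streakPullAt_of_streakEvent (h : IsRun P μ π A R) (hπ : IsUCB π)
    (hμ : (μ 1 : ℝ) < μ 0) {w : ℕ → Bool} {s : ℕ} (hw : IsOptimisticWord (μ 0) (μ 1) w s) {c : ℝ}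
    (hc : Tendsto (fun k => P.real (streakEvent A R k w s)) atTop (nhds c)) :
    Tendsto (fun k => P.real (⋃ n, streakPullAt A R k w s n)) atTop (nhds c) := by
  have := hc.sub (h.tendsto_real_streak_stops hπ hμ hw)
  rw [sub_zero] at this
  refine this.congr fun k => ?_
  rw [measureReal_sdiff (iUnion_streakPullAt_subset k w s)
    (h.measurableSet_iUnion_streakPullAt k w s)]
  ring

/-- Induction on `s`: an optimistic word almost never stops the streak in the limit, and the next
reward then contributes an exact Bernoulli factor. -/
lemma IsRun.tendsto_real_streakEvent (h : IsRun P μ π A R) (hπ : IsUCB π)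
    (hμ : (μ 1 : ℝ) < μ 0) {w : ℕ → Bool} {s : ℕ} (hw : IsOptimisticWord (μ 0) (μ 1) w s) :
    Tendsto (fun k => P.real (streakEvent A R k w s)) atTop
      (nhds (∏ i ∈ Finset.range s, (bernoulliMeasure true false (μ 1)).real {w i})) := by
  induction s with
  | zero => simp [h.real_streakEvent_zero hπ]
  | succ s ih =>
    have hw' : IsOptimisticWord (μ 0) (μ 1) w s := fun t ht hts => hw t ht (by omega)
    rw [Finset.prod_range_succ]
    simp only [h.real_streakEvent_succ]
    exact (h.tendsto_real_iUnion_streakPullAt_of_streakEvent hπ hμ hw' (ih hw')).mul_const _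

lemma IsRun.tendsto_real_iUnion_streakPullAt (h : IsRun P μ π A R) (hπ : IsUCB π)
    (hμ : (μ 1 : ℝ) < μ 0) {w : ℕ → Bool} {s : ℕ} (hw : IsOptimisticWord (μ 0) (μ 1) w s) :
    Tendsto (fun k => P.real (⋃ n, streakPullAt A R k w s n)) atTop
      (nhds (∏ i ∈ Finset.range s, (bernoulliMeasure true false (μ 1)).real {w i})) :=
  h.tendsto_real_iUnion_streakPullAt_of_streakEvent hπ hμ hw (h.tendsto_real_streakEvent hπ hμ hw)

/-- The word can be read off the rewards following the start of the episode, so different words give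
disjoint events. -/
lemma IsRun.sum_real_streakPull_le (h : IsRun P μ π A R) (k s : ℕ) (W : Finset (Fin s → Bool)) :
    ∑ w ∈ W, P.real (⋃ n, streakPullAt A R k (extendWord w) s n) ≤
      P.real (⋃ n, windowPullAt A k s n) := by
  rw [← measureReal_biUnion_finset ?_ fun w _ => h.measurableSet_iUnion_streakPullAt k _ s]
  · refine measureReal_mono (Set.iUnion₂_subset fun w _ ω hω => ?_)
    obtain ⟨m, hm, -, hA⟩ := mem_iUnion_streakPullAt.1 hω
    exact mem_iUnion_windowPullAt.2 ⟨m, hm, hA⟩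
  · intro w _ w' _ hne
    refine Set.disjoint_left.2 fun ω hω hω' => hne ?_
    obtain ⟨m, hm, hr, -⟩ := mem_iUnion_streakPullAt.1 hω
    obtain ⟨m', hm', hr', -⟩ := mem_iUnion_streakPullAt.1 hω'
    obtain rfl : m = m' := Nat.cast_injective (hm.symm.trans hm')
    ext i
    rw [← extendWord_apply w i, ← extendWord_apply w' i, ← (hr i i.2).2, ← (hr' i i.2).2]

/-! ### The expected regret of an exploration episode -/

lemma IsRun.integral_explorationRegret (h : IsRun P μ π A R) (k T : ℕ) :
    ∫ ω, explorationRegret μ (fun t => A t ω) k T ∂P =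
      ((μ 0 : ℝ) - μ 1) * ∑ s ∈ Finset.range T, P.real (⋃ n, windowPullAt A k s n) := by
  simp only [explorationRegret_eq_sum]
  rw [integral_finsetSum _ fun s _ =>
    (integrable_const _).indicator (h.measurableSet_iUnion_windowPullAt k s), Finset.mul_sum]
  refine Finset.sum_congr rfl fun s _ => ?_
  rw [integral_indicator_const _ (h.measurableSet_iUnion_windowPullAt k s), smul_eq_mul, mul_comm]

lemma IsRun.le_regExp (h : IsRun P μ π A R) (hπ : IsUCB π) (hμ : (μ 1 : ℝ) < μ 0) (T : ℕ) :
    ((μ 0 : ℝ) - μ 1) * ∑ s ∈ Finset.range T, ∑ w ∈ optimisticWords (μ 0) (μ 1) s,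
      ∏ i ∈ Finset.range s, (bernoulliMeasure true false (μ 1)).real {extendWord w i} ≤
    regExp P μ A T := by
  have hgap : 0 ≤ (μ 0 : ℝ) - μ 1 := by linarith
  have hlim : Tendsto (fun k => ((μ 0 : ℝ) - μ 1) * ∑ s ∈ Finset.range T,
      ∑ w ∈ optimisticWords (μ 0) (μ 1) s, P.real (⋃ n, streakPullAt A R k (extendWord w) s n))
      atTop (nhds (((μ 0 : ℝ) - μ 1) * ∑ s ∈ Finset.range T, ∑ w ∈ optimisticWords (μ 0) (μ 1) s,
        ∏ i ∈ Finset.range s, (bernoulliMeasure true false (μ 1)).real {extendWord w i})) := by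
    refine (tendsto_finsetSum _ fun s _ => tendsto_finsetSum _ fun w hw => ?_).const_mul _
    exact h.tendsto_real_iUnion_streakPullAt hπ hμ (mem_optimisticWords.1 hw)
  rw [← hlim.limsup_eq, regExp]
  refine limsup_le_limsup (Eventually.of_forall fun k => ?_) ?_ ?_
  · simp only
    rw [h.integral_explorationRegret]
    gcongr with s _
    exact h.sum_real_streakPull_le k s _
  · exact hlim.isCoboundedUnder_le
  -- A real `limsup` is meaningful only for bounded sequences; here each probability is at most 1.
  · refine isBoundedUnder_of ⟨((μ 0 : ℝ) - μ 1) * ∑ s ∈ Finset.range T, 1, fun k => ?_⟩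
    rw [h.integral_explorationRegret]
    gcongr with s _
    exact measureReal_le_one

end Run

/-! ### The stopping time of the random walk -/

lemma lt_walkTime_iff {m₁ m₂ : ℝ} {T s : ℕ} (hs : s < T) {x : ℕ → ℝ} :
    s < walkTime m₁ m₂ T x ↔ ∀ t, 1 ≤ t → t ≤ s →
      0 < -(m₁ - m₂) / 2 + 1 / (t : ℝ) * ∑ i ∈ Finset.Icc 1 t, (x i - m₂) := by
  set p : ℕ → Prop := fun t =>
    1 ≤ t ∧ -(m₁ - m₂) / 2 + 1 / (t : ℝ) * ∑ i ∈ Finset.Icc 1 t, (x i - m₂) ≤ 0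
  have hne : min (T : ℕ∞) (firstTime p) ≠ ⊤ :=
    ne_top_of_le_ne_top (ENat.natCast_ne_top T) (min_le_left _ _)
  have h1 : s < walkTime m₁ m₂ T x ↔ ((s : ℕ) : ℕ∞) < min (T : ℕ∞) (firstTime p) := by
    rw [← ENat.natCast_toNat hne, Nat.cast_lt]
    rfl
  have h2 : ((s : ℕ) : ℕ∞) < T := by exact_mod_cast hs
  rw [h1, lt_min_iff, and_iff_right h2]
  constructor
  · intro hlt t ht hts
    by_contra! hle
    have : firstTime p ≤ t := iInf₂_le t ⟨ht, hle⟩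
    exact absurd (hlt.trans_le this) (not_lt.2 (by exact_mod_cast hts))
  · intro hall
    have : ((s + 1 : ℕ) : ℕ∞) ≤ firstTime p := le_iInf₂ fun t ht => by
      have : ¬ t ≤ s := fun hts => absurd ht.2 (not_le.2 (hall t ht.1 hts))
      exact_mod_cast (by omega : s + 1 ≤ t)
    exact lt_of_lt_of_le (by exact_mod_cast Nat.lt_succ_self s) this

lemma walkTime_le (m₁ m₂ : ℝ) (T : ℕ) (x : ℕ → ℝ) : walkTime m₁ m₂ T x ≤ T :=
  ENat.toNat_le_of_le_natCast (min_le_left _ _)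

/-- The real number encoded by a Boolean reward. -/
def rewardValue (r : Bool) : ℝ := if r = true then 1 else 0

lemma sum_sub_eq_count {x : ℕ → ℝ} {w : ℕ → Bool} {t : ℕ} (m : ℝ)
    (h : ∀ i < t, x (i + 1) = rewardValue (w i)) :
    ∑ i ∈ Finset.Icc 1 t, (x i - m) = (Nat.count (fun i => w i = true) t : ℝ) - t * m := by
  induction t with
  | zero => simp
  | succ t ih =>
    rw [Finset.sum_Icc_succ_top (by omega), ih fun i hi => h i (by omega), h t (by omega),
      Nat.count_succ, rewardValue]
    push_cast
    ring

lemma walkTime_eq_sum (m₁ m₂ : ℝ) (T : ℕ) (x : ℕ → ℝ) :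
    (walkTime m₁ m₂ T x : ℝ) =
      ∑ s ∈ Finset.range T, if s < walkTime m₁ m₂ T x then (1 : ℝ) else 0 := by
  rw [Finset.sum_ite, Finset.sum_const_zero, add_zero, Finset.sum_const, nsmul_eq_mul, mul_one]
  congr 1
  have : (Finset.range T).filter (fun s => s < walkTime m₁ m₂ T x) =
      Finset.range (walkTime m₁ m₂ T x) := by
    ext s
    have := walkTime_le m₁ m₂ T x
    simp only [Finset.mem_filter, Finset.mem_range]
    omega
  rw [this, Finset.card_range]

/-! ### Words of the walk and its expected stopping time -/

section Walk

variable {Ω' : Type*} [MeasurableSpace Ω'] {P' : Measure Ω'}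
  {X : ℕ → Ω' → ℝ} {p : unitInterval}

/-- The first `s` steps of the walk are given by the word `w`. -/
def wordEvent (X : ℕ → Ω' → ℝ) {s : ℕ} (w : Fin s → Bool) : Set Ω' :=
  ⋂ i ∈ Finset.range s, X (i + 1) ⁻¹' {rewardValue (extendWord w i)}

lemma bernoulliMeasure_real_rewardValue (p : unitInterval) (r : Bool) :
    (bernoulliMeasure (1 : ℝ) 0 p).real {rewardValue r} =
      (bernoulliMeasure true false p).real {r} := by
  cases r <;> simp [rewardValue]

lemma nullMeasurableSet_wordEvent (hX : ∀ i, HasLaw (X i) (bernoulliMeasure (1 : ℝ) 0 p) P')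
    {s : ℕ} (w : Fin s → Bool) : NullMeasurableSet (wordEvent X w) P' :=
  Finset.nullMeasurableSet_biInter _ fun i _ =>
    (hX (i + 1)).aemeasurable.nullMeasurableSet_preimage (measurableSet_singleton _)

lemma real_wordEvent (hindep : iIndepFun X P')
    (hX : ∀ i, HasLaw (X i) (bernoulliMeasure (1 : ℝ) 0 p) P') {s : ℕ} (w : Fin s → Bool) :
    P'.real (wordEvent X w) =
      ∏ i ∈ Finset.range s, (bernoulliMeasure true false p).real {extendWord w i} := by
  -- The shift matches steps numbered from 1 with letters numbered from 0.
  have h := (hindep.precomp (Nat.succ_injective)).measure_inter_preimage_eq_mul (Finset.range s)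
    (sets := fun i => {rewardValue (extendWord w i)}) fun i _ => measurableSet_singleton _
  rw [measureReal_def, wordEvent]
  refine (congrArg ENNReal.toReal h).trans ?_
  rw [ENNReal.toReal_prod]
  refine Finset.prod_congr rfl fun i _ => ?_
  rw [← bernoulliMeasure_real_rewardValue, measureReal_def, ← (hX (i + 1)).map_eq,
    Measure.map_apply_of_aemeasurable (hX (i + 1)).aemeasurable (measurableSet_singleton _)]

lemma ae_exists_rewardValue (hX : ∀ i, HasLaw (X i) (bernoulliMeasure (1 : ℝ) 0 p) P') :
    ∀ᵐ ω ∂P', ∀ i, ∃ r, X i ω = rewardValue r := by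
  rw [ae_all_iff]
  intro i
  have hae : ∀ᵐ y ∂(bernoulliMeasure (1 : ℝ) 0 p), ∃ r, y = rewardValue r := by
    have hset : MeasurableSet {y : ℝ | ∃ r, y = rewardValue r} := by
      have : {y : ℝ | ∃ r, y = rewardValue r} = Set.range rewardValue := by
        ext y; simp
      rw [this]
      exact (Set.finite_range _).measurableSet
    refine (mem_ae_iff_prob_eq_one hset).2 ?_
    refine bernoulliMeasure_apply_of_mem_of_mem p hset ⟨true, ?_⟩ ⟨false, ?_⟩ <;>
      simp [rewardValue]
  rw [← (hX i).map_eq] at hae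
  exact ae_of_ae_map (hX i).aemeasurable hae

variable [IsProbabilityMeasure P']

lemma integral_walkTime_le (hindep : iIndepFun X P') (m₁ m₂ : ℝ)
    (hX : ∀ i, HasLaw (X i) (bernoulliMeasure (1 : ℝ) 0 p) P') (T : ℕ) :
    ∫ ω, (walkTime m₁ m₂ T (fun i => X i ω) : ℝ) ∂P' ≤
      ∑ s ∈ Finset.range T, ∑ w ∈ optimisticWords m₁ m₂ s,
        ∏ i ∈ Finset.range s, (bernoulliMeasure true false p).real {extendWord w i} := by
  have hint : ∀ (s : ℕ) (w : Fin s → Bool),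
      Integrable ((wordEvent X w).indicator fun _ => (1 : ℝ)) P' := fun s w =>
    (integrable_const _).indicator₀ (nullMeasurableSet_wordEvent hX w)
  have hval : ∫ ω, ∑ s ∈ Finset.range T, ∑ w ∈ optimisticWords m₁ m₂ s,
      (wordEvent X w).indicator (fun _ => (1 : ℝ)) ω ∂P' =
      ∑ s ∈ Finset.range T, ∑ w ∈ optimisticWords m₁ m₂ s,
        ∏ i ∈ Finset.range s, (bernoulliMeasure true false p).real {extendWord w i} := by
    rw [integral_finsetSum _ fun s _ => integrable_finsetSum _ fun w _ => hint s w]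
    refine Finset.sum_congr rfl fun s _ => ?_
    rw [integral_finsetSum _ fun w _ => hint s w]
    refine Finset.sum_congr rfl fun w _ => ?_
    rw [integral_indicator₀ (nullMeasurableSet_wordEvent hX w), setIntegral_const, smul_eq_mul,
      mul_one, real_wordEvent hindep hX]
  rw [← hval]
  -- Only the upper bound is needed, and in this form it requires no measurability of the stopping
  -- time.
  refine integral_mono_of_nonneg (Eventually.of_forall fun ω => Nat.cast_nonneg _)
    (integrable_finsetSum _ fun s _ => integrable_finsetSum _ fun w _ => hint s w) ?_
  filter_upwards [ae_exists_rewardValue hX] with ω hω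
  choose v hv using hω
  rw [walkTime_eq_sum]
  refine Finset.sum_le_sum fun s hs => ?_
  have hnonneg : ∀ w ∈ optimisticWords m₁ m₂ s,
      0 ≤ (wordEvent X w).indicator (fun _ => (1 : ℝ)) ω := fun w _ =>
    Set.indicator_nonneg (fun _ _ => zero_le_one) _
  split_ifs with hlt
  · let w : Fin s → Bool := fun i => v (i + 1)
    have hwv : ∀ i < s, extendWord w i = v (i + 1) := fun i hi => extendWord_apply w ⟨i, hi⟩
    have hmem : ω ∈ wordEvent X w := by
      simp only [wordEvent, Set.mem_iInter, Set.mem_preimage, Set.mem_singleton_iff]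
      intro i hi
      rw [hwv i (Finset.mem_range.1 hi), hv]
    have hopt : w ∈ optimisticWords m₁ m₂ s := by
      refine mem_optimisticWords.2 fun t ht hts => ?_
      have h1 := (lt_walkTime_iff (Finset.mem_range.1 hs)).1 hlt t ht hts
      have ht0 : (0 : ℝ) < t := by exact_mod_cast ht
      rw [sum_sub_eq_count (w := extendWord w) m₂ fun i hi => by
        rw [hwv i (by omega)]; exact hv (i + 1)] at h1
      have h2 := mul_pos ht0 h1
      -- Multiplied by `t`, the condition for not having stopped becomes that of an optimistic word.
      have h3 : ∀ c : ℝ, (t : ℝ) * (-(m₁ - m₂) / 2 + 1 / (t : ℝ) * (c - t * m₂)) =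
          c - t * m₂ - t * (m₁ - m₂) / 2 := fun c => by field_simp; ring
      rwa [h3] at h2
    calc (1 : ℝ) = (wordEvent X w).indicator (fun _ => (1 : ℝ)) ω :=
          (Set.indicator_of_mem hmem fun _ => (1 : ℝ)).symm
      _ ≤ _ := Finset.single_le_sum hnonneg hopt
  · exact Finset.sum_nonneg hnonneg

end Walk

end TwoArmBandit

end

theorem mainTheorem6
    (μ : Fin 2 → unitInterval) (hμ₂ : 0 < (μ 1 : ℝ)) (hμ : (μ 1 : ℝ) < μ 0) (hμ₁ : (μ 0 : ℝ) < 1)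
    (π : TwoArmBandit.Policy) (hπ : TwoArmBandit.IsUCB π)
    {Ω : Type*} [MeasurableSpace Ω] (P : Measure Ω) [IsProbabilityMeasure P]
    (A : ℕ → Ω → Fin 2) (R : ℕ → Ω → Bool) (hrun : TwoArmBandit.IsRun P μ π A R)
    {Ω' : Type*} [MeasurableSpace Ω'] (P' : Measure Ω') [IsProbabilityMeasure P']
    (X : ℕ → Ω' → ℝ) (hX_indep : iIndepFun X P')
    (hX_law : ∀ i, HasLaw (X i) (bernoulliMeasure (1 : ℝ) 0 (μ 1)) P')
    (T : ℕ) (hT : 1 ≤ T) :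
    (∀ k, ∀ᵐ ω ∂P, TwoArmBandit.explorationEpisode (fun t => A t ω) k ≠ ⊤) ∧
      TwoArmBandit.regExp P μ A T ≥
        ((μ 0 : ℝ) - μ 1) *
          ∫ ω, (TwoArmBandit.walkTime (μ 0) (μ 1) T (fun i => X i ω) : ℝ) ∂P' := by
  refine ⟨fun k => hrun.ae_explorationEpisode_ne_top hπ k, ?_⟩
  refine le_trans (mul_le_mul_of_nonneg_left ?_ (sub_nonneg.2 hμ.le)) (hrun.le_regExp hπ hμ T)
  exact TwoArmBandit.integral_walkTime_le hX_indep _ _ hX_law T
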